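/- Let $p$ be an odd prime and let $0<\alpha<\beta$ be integers. A set $A\subseteq\mathbb Z_{p^\beta}=\mathbb Z/p^\beta\mathbb Z$ with $|A|=p^\alpha$ is called a digital set if it is a complete set of representatives for the cosets of $p^\alpha\mathbb Z_{p^\beta}$. For $A,B\subseteq\mathbb Z_{p^\beta}$ let $r_{A+B}(x)$ be the number of pairs $(a,b)\in A\times B$ with $a+b=x$, let $A+_iB=\{x\in A+B: r_{A+B}(x)\ge i\}$, and let $$S(A,B,t)=\sum_{i=1}^t|A+_iB|=\sum_{x\in\mathbb Z_{p^\beta}}\min(t,r_{A+B}(x)).$$ Let $A,B\subseteq\mathbb Z_{p^\beta}$ be digital sets with $|A|=|B|=p^\alpha$. Then: (i) $S\left(A,B,\frac{p^\alpha-1}{2}\right)\ge\frac{3p^{2\alpha}-2p^\alpha-1}{4}$; (ii) $S\left(A,B,\frac{p^\alpha+1}{2}\right)\ge\frac{3p^{2\alpha}+2p^\alpha-1}{4}$; (iii) $S\left(A,B,\frac{p^\alpha-1}{2}\right)=\frac{3p^{2\alpha}-2p^\alpha-1}{4}$ if and only if $A$ and $B$ are arithmetic progressions with the same common difference; (iv)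 except in the case $p=3$, $\alpha=1$, $\beta\ge3$, $S\left(A,B,\frac{p^\alpha+1}{2}\right)=\frac{3p^{2\alpha}+2p^\alpha-1}{4}$ if and only if $A$ and $B$ are arithmetic progressions with the same common difference. -/

import Mathlib

/-- `A ⊆ ℤ/qℤ` is a digital set of size `m`: it has `m` elements and is a complete set of
representatives for the cosets of `m(ℤ/qℤ)`, each coset containing exactly one element of `A`. -/
def IsDigitalSet {q : ℕ} (m : ℕ) (A : Finset (ZMod q)) : Prop :=
  A.card = m ∧ ∀ x : ZMod q, ∃! a, a ∈ A ∧ x - a ∈ AddSubgroup.zmultiples (m : ZMod q)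

/-- The number `r_{A+B}(x)` of pairs `(a, b) ∈ A × B` with `a + b = x`. -/
def repCount {q : ℕ} (A B : Finset (ZMod q)) (x : ZMod q) : ℕ :=
  ((A ×ˢ B).filter (fun z => z.1 + z.2 = x)).card

/-- The set `A +_i B` of the elements of the sumset `A + B` with at least `i` representations. -/
def popularSumset {q : ℕ} (A B : Finset (ZMod q)) (i : ℕ) : Finset (ZMod q) :=
  ((A ×ˢ B).image (fun z => z.1 + z.2)).filter (fun x => i ≤ repCount A B x)

/-- `S(A, B, t) = ∑_{i=1}^t |A +_i B|`. -/
def pollardSum {q : ℕ} (A B : Finset (ZMod q)) (t : ℕ) : ℕ :=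
  ∑ i ∈ Finset.Icc 1 t, (popularSumset A B i).card

/-- `A` is an arithmetic progression `{a, a + d, …, a + (|A| - 1) d}` of common difference `d`. -/
def IsArithProgWithDiff {q : ℕ} (A : Finset (ZMod q)) (d : ZMod q) : Prop :=
  ∃ a : ZMod q, A = (Finset.range A.card).image (fun i : ℕ => a + (i : ZMod q) * d)

/-- The second expression `S(A, B, t) = ∑_x min(t, r_{A+B}(x))`. -/
theorem pollardSum_eq_sum_min {q : ℕ} [NeZero q] (A B : Finset (ZMod q)) (t : ℕ) :
    pollardSum A B t = ∑ x : ZMod q, min t (repCount A B x) := by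
  have h : ∀ i ∈ Finset.Icc 1 t, (popularSumset A B i).card
      = ∑ x : ZMod q, if i ≤ repCount A B x then 1 else 0 := by
    intro i hi
    rw [← Finset.card_filter]
    congr 1
    ext x
    simp only [popularSumset, Finset.mem_filter, Finset.mem_image, Finset.mem_univ, true_and,
      and_iff_right_iff_imp]
    intro hx
    have hpos : 0 < repCount A B x := lt_of_lt_of_le (Finset.mem_Icc.mp hi).1 hx
    obtain ⟨z, hz⟩ := Finset.card_pos.mp hpos
    exact ⟨z, (Finset.mem_filter.mp hz).1, (Finset.mem_filter.mp hz).2⟩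
  rw [pollardSum, Finset.sum_congr rfl h, Finset.sum_comm]
  refine Finset.sum_congr rfl fun x _ => ?_
  rw [← Finset.card_filter]
  have : (Finset.Icc 1 t).filter (fun i => i ≤ repCount A B x)
      = Finset.Icc 1 (min t (repCount A B x)) := by
    ext i
    simp only [Finset.mem_filter, Finset.mem_Icc, le_min_iff, and_assoc]
  rw [this, Nat.card_Icc, Nat.add_sub_cancel]

/-! Write `exc A B t` for the sum of the positive parts of r(x) - t, so that S(A, B, t) and `exc A B
t` add up to |A||B|. With |A| = |B| = 2r + 1 the claims say that Pollard's bound (|A| - t)(|B| - t)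
for the excess holds at t = r and t = r + 1 and is attained by progressions only.

The Dyson transform gives Pollard's bound when differences have order at least |A| + |B| (`exc_le`).
For equality (`Extremal.exists_isAP`), a partner in an extremal pair can be cut down to its
intersection with a translate (`Extremal.inter_vadd`) or traded for the set of popular sums
(`Extremal.dual`). When neither set has a large self-intersection, additive energy leaves only sets
of size 2t with t ≤ 2 (`Extremal.irreducible_cases`). Progressions propagate back by
`Extremal.isAP`. This settles α = 1, where nonzero differences have order at least p², except that p
= 3, β = 2 needs a separate argument at level r + 1.

From α to α + 1 (p = 2h + 1, p^α = 2l + 1), fibre the sets over ℤ/p^α. Fibres have size p and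
differences of order at least p². A sum with more than half of the possible representations is alone
in its class modulo p^(α+1), so each fibre contains at most p popular sums. Pollard's bound, applied
to each pair of fibres, limits the representations of these sums. A pair reaching the maximum 3h² +
3h + 1 consists of progressions whose centres add up to the centre of the popular set. The surplus
is therefore governed by the sumset of the sets of centres, which are transversals modulo p^α
(`Tower.Centres.exc_le`). In the equality case the fibres are progressions of one difference d, the
centres form progressions of difference e, and p^α e = ±d glues them together (`Tower.exists_isAP`).

Level r follows from level r + 1, because at most 2r + 1 sums have more than r representations. -/

namespace DigitalPollard

open Finset
open scoped Pointwise

set_option linter.unusedSectionVars false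

/-! ### Pollard's inequality, extremal pairs and duality -/

section Basic

variable {G : Type*} [AddCommGroup G] [DecidableEq G]

/-- The number of representations of `x` as a sum `a + b` with `a ∈ A`, `b ∈ B`. -/
def rep (A B : Finset G) (x : G) : ℕ := #{a ∈ A | x - a ∈ B}

theorem rep_comm (A B : Finset G) (x : G) : rep A B x = rep B A x := by
  refine card_bij' (fun a _ => x - a) (fun a _ => x - a) ?_ ?_ ?_ ?_ <;>
    simp +contextual [mem_filter]

theorem rep_le_card_left (A B : Finset G) (x : G) : rep A B x ≤ #A := card_filter_le _ _

theorem rep_le_card_right (A B : Finset G) (x : G) : rep A B x ≤ #B :=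
  rep_comm A B x ▸ rep_le_card_left B A x

theorem rep_mono_left {A A' : Finset G} (h : A ⊆ A') (B : Finset G) (x : G) :
    rep A B x ≤ rep A' B x := card_le_card (filter_subset_filter _ h)

theorem rep_mono_right (A : Finset G) {B B' : Finset G} (h : B ⊆ B') (x : G) :
    rep A B x ≤ rep A B' x := by
  rw [rep_comm A, rep_comm A]; exact rep_mono_left h A x

theorem rep_union_add_rep_inter (A A' B : Finset G) (x : G) :
    rep (A ∪ A') B x + rep (A ∩ A') B x = rep A B x + rep A' B x := by
  unfold rep
  rw [filter_union, filter_inter_distrib, card_union_add_card_inter]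

theorem rep_union_of_disjoint {A A' : Finset G} (h : Disjoint A A') (B : Finset G) (x : G) :
    rep (A ∪ A') B x = rep A B x + rep A' B x := by
  have := rep_union_add_rep_inter A A' B x
  rw [disjoint_iff_inter_eq_empty.1 h] at this
  simpa [rep] using this

theorem mem_vadd_iff {g x : G} {B : Finset G} : x ∈ g +ᵥ B ↔ x - g ∈ B := by
  rw [mem_vadd_finset]
  constructor
  · rintro ⟨y, hy, rfl⟩; simpa using hy
  · intro h; exact ⟨x - g, h, by simp⟩

theorem rep_vadd_right (A B : Finset G) (g x : G) : rep A (g +ᵥ B) x = rep A B (x - g) := by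
  unfold rep
  congr 1; ext a
  simp only [mem_filter, mem_vadd_iff, sub_right_comm]

/-- The identity behind the Dyson transform of a pair of sets. -/
theorem rep_eq_rep_union_inter_add (A B : Finset G) (x : G) :
    rep A B x = rep (A ∪ B) (A ∩ B) x + rep (A \ B) (B \ A) x := by
  have hA : rep A B x = rep (A \ B) B x + rep (A ∩ B) B x := by
    rw [← rep_union_of_disjoint (disjoint_sdiff_inter A B), sdiff_union_inter]
  have hB : rep (A \ B) B x = rep (A \ B) (B \ A) x + rep (A \ B) (A ∩ B) x := by
    rw [rep_comm _ B, rep_comm _ (B \ A), rep_comm _ (A ∩ B),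
      ← rep_union_of_disjoint, inter_comm A B, sdiff_union_inter]
    rw [inter_comm A B]; exact disjoint_sdiff_inter B A
  have hU : rep (A ∪ B) (A ∩ B) x = rep (A \ B) (A ∩ B) x + rep B (A ∩ B) x := by
    rw [← rep_union_of_disjoint sdiff_disjoint, sdiff_union_self_eq_union]
  rw [hA, hB, hU, rep_comm B]; ring

theorem rep_pos_iff {A B : Finset G} {x : G} : 0 < rep A B x ↔ ∃ a ∈ A, ∃ b ∈ B, a + b = x := by
  unfold rep
  rw [card_pos]
  constructor
  · rintro ⟨a, ha⟩
    rw [mem_filter] at ha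
    exact ⟨a, ha.1, x - a, ha.2, by abel⟩
  · rintro ⟨a, ha, b, hb, rfl⟩
    exact ⟨a, by simp [ha, hb]⟩

variable [Fintype G]

theorem sum_rep (A B : Finset G) : ∑ x, rep A B x = #A * #B := by
  unfold rep
  simp_rw [card_filter]
  rw [sum_comm]
  have : ∀ a ∈ A, (∑ x : G, if x - a ∈ B then 1 else 0) = #B := by
    intro a _
    rw [← card_filter]
    refine card_bij' (fun x _ => x - a) (fun b _ => b + a) ?_ ?_ ?_ ?_ <;> simp
  rw [sum_congr rfl this]; simp

/-- The excess `∑ (r(x) - t)⁺` of the representation function over the level `t`. -/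
def exc (A B : Finset G) (t : ℕ) : ℕ := ∑ x, (rep A B x - t)

theorem exc_comm (A B : Finset G) (t : ℕ) : exc A B t = exc B A t := by
  simp only [exc, rep_comm A B]

theorem exc_vadd_right (A B : Finset G) (g : G) (t : ℕ) : exc A (g +ᵥ B) t = exc A B t := by
  simp only [exc, rep_vadd_right]
  exact Fintype.sum_equiv (Equiv.subRight g) _ _ (fun x => rfl)

/-- All differences of distinct elements have order at least `Q`. -/
def LargeDiff (Q : ℕ) (B : Finset G) : Prop :=
  ∀ x ∈ B, ∀ y ∈ B, x ≠ y → Q ≤ addOrderOf (x - y)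

theorem LargeDiff.mono {Q : ℕ} {B B' : Finset G} (h : LargeDiff Q B) (hs : B' ⊆ B) :
    LargeDiff Q B' := fun x hx y hy hxy => h x (hs hx) y (hs hy) hxy

theorem LargeDiff.vadd {Q : ℕ} {B : Finset G} (h : LargeDiff Q B) (g : G) :
    LargeDiff Q (g +ᵥ B) := by
  intro x hx y hy hxy
  rw [mem_vadd_iff] at hx hy
  have := h _ hx _ hy (by simpa using hxy)
  simpa using this

theorem LargeDiff.neg {Q : ℕ} {B : Finset G} (h : LargeDiff Q B) : LargeDiff Q (-B) := by
  intro x hx y hy hxy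
  rw [mem_neg'] at hx hy
  have := h _ hy _ hx (by simpa using hxy.symm)
  rwa [neg_sub_neg] at this

/-- A nonempty set closed under translation by `g` has at least `addOrderOf g` elements. -/
theorem addOrderOf_le_card_of_closed {A : Finset G} {a g : G} (ha : a ∈ A)
    (h : ∀ x ∈ A, x + g ∈ A) : addOrderOf g ≤ #A := by
  have hmem : ∀ i : ℕ, a + i • g ∈ A := by
    intro i
    induction i with
    | zero => simpa
    | succ i ih => rw [succ_nsmul, ← add_assoc]; exact h _ ih
  rw [← card_range (addOrderOf g)]
  refine card_le_card_of_injOn (fun i => a + i • g) (fun i _ => hmem i) ?_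
  intro i hi j hj hij
  have := add_left_cancel hij
  exact nsmul_injOn_Iio_addOrderOf (by simpa using hi) (by simpa using hj) this

/-- Pollard's inequality, for a set all of whose differences have large order. -/
theorem exc_le {Q : ℕ} {A B : Finset G} {t : ℕ} (hB : LargeDiff Q B) (hQ : #A + #B ≤ Q)
    (hA : t ≤ #A) (hBt : t ≤ #B) : exc A B t ≤ (#A - t) * (#B - t) := by
  induction hn : #B using Nat.strong_induction_on generalizing A B t with
  | _ n ih =>
  rcases Nat.eq_zero_or_pos t with rfl | ht
  · simp [exc, sum_rep, hn]
  rcases hBt.eq_or_lt with h | h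
  · have : exc A B t = 0 := by
      refine sum_eq_zero fun x _ => ?_
      have := rep_le_card_right A B x
      omega
    omega
  -- Otherwise every translate of B meeting A lies in A, and A is closed under a difference b' - b
  -- whose order exceeds |A|.
  have key : ∃ e : G, (A ∩ (e +ᵥ B)).Nonempty ∧ ¬ (e +ᵥ B) ⊆ A := by
    by_contra hcon
    push Not at hcon
    obtain ⟨b, hb, b', hb', hbb⟩ := one_lt_card.1 (lt_of_le_of_lt ht h)
    obtain ⟨a, ha⟩ := card_pos.1 (lt_of_lt_of_le ht hA)
    have hcl : ∀ x ∈ A, x + (b' - b) ∈ A := by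
      intro x hx
      refine hcon (x - b) ⟨x, ?_⟩ ?_
      · simp [mem_vadd_iff, hx, hb]
      · simpa [mem_vadd_iff] using hb'
    have h1 := addOrderOf_le_card_of_closed ha hcl
    have h2 := hB b' hb' b hb (Ne.symm hbb)
    omega
  obtain ⟨e, hne, hns⟩ := key
  set C := e +ᵥ B with hC
  have hCB : #C = #B := card_vadd_finset e B
  have hCL : LargeDiff Q C := hB.vadd e
  have hs0 : 0 < #(A ∩ C) := card_pos.2 hne
  have hs1 : #(A ∩ C) < #C := by
    refine card_lt_card (ssubset_of_subset_of_ne inter_subset_right ?_)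
    intro heq; exact hns (inter_eq_right.1 heq)
  have hU : #(A ∪ C) + #(A ∩ C) = #A + #C := card_union_add_card_inter A C
  have hA2 : #(A \ C) + #(A ∩ C) = #A := card_sdiff_add_card_inter A C
  have hC2 : #(C \ A) + #(A ∩ C) = #C := by
    rw [inter_comm]; exact card_sdiff_add_card_inter C A
  rw [← hn, ← exc_vadd_right A B e, ← hC]
  -- If t ≤ |A ∩ C|, the pair of set differences is charged its whole mass. If t > |A ∩ C|, the
  -- union and intersection contribute at most |A ∩ C| to each sum, which only lowers the level for
  -- the other pair.
  rcases le_or_gt t #(A ∩ C) with hts | hts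
  · have h1 := ih #(A ∩ C) (by omega) (A := A ∪ C) (B := A ∩ C) (t := t)
      (hCL.mono inter_subset_right) (by omega) (by omega) hts rfl
    have h2 : exc A C t ≤ exc (A ∪ C) (A ∩ C) t + #(A \ C) * #(C \ A) := by
      rw [← sum_rep, exc, exc, ← sum_add_distrib]
      refine sum_le_sum fun x _ => ?_
      rw [rep_eq_rep_union_inter_add A C x]; omega
    refine h2.trans ((Nat.add_le_add_right h1 _).trans (le_of_eq ?_))
    obtain ⟨σ, hσ⟩ := Nat.exists_eq_add_of_le hts
    obtain ⟨u, hu⟩ : ∃ u, u = #(A \ C) := ⟨_, rfl⟩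
    obtain ⟨v, hv⟩ : ∃ v, v = #(C \ A) := ⟨_, rfl⟩
    rw [← hu, ← hv, hσ, show #(A ∪ C) - t = u + v + σ by omega,
      show t + σ - t = σ by omega, show #A - t = u + σ by omega, show #B - t = v + σ by omega]
    ring
  · have h1 := ih #(C \ A) (by omega) (A := A \ C) (B := C \ A) (t := t - #(A ∩ C))
      (hCL.mono sdiff_subset) (by omega) (by omega) (by omega) rfl
    have h2 : exc A C t ≤ exc (A \ C) (C \ A) (t - #(A ∩ C)) := by
      refine sum_le_sum fun x _ => ?_
      have := rep_le_card_right (A ∪ C) (A ∩ C) x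
      rw [rep_eq_rep_union_inter_add A C x]; omega
    refine h2.trans (h1.trans (le_of_eq ?_))
    congr 1 <;> omega

/-- The pair `(A, B)` attains Pollard's bound at the level `t`. -/
def Extremal (A B : Finset G) (t : ℕ) : Prop := exc A B t = (#A - t) * (#B - t)

theorem Extremal.symm {A B : Finset G} {t : ℕ} (h : Extremal A B t) : Extremal B A t := by
  unfold Extremal at *; rw [exc_comm, h, mul_comm]

theorem exc_le' {Q : ℕ} {A B : Finset G} {t : ℕ} (hA : LargeDiff Q A) (hQ : #A + #B ≤ Q)
    (hAt : t ≤ #A) (hBt : t ≤ #B) : exc A B t ≤ (#A - t) * (#B - t) := by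
  rw [exc_comm, mul_comm]; exact exc_le hA (by omega) hBt hAt

/-- Extremal partners of a fixed set are closed under intersection with their translates. -/
theorem Extremal.inter_vadd {Q : ℕ} {A B : Finset G} {t : ℕ} (h : Extremal A B t)
    (hA : LargeDiff Q A) (hQ : #A + 2 * #B ≤ Q) (hAt : t ≤ #A) (g : G)
    (hg : t ≤ #(B ∩ (g +ᵥ B))) : Extremal A (B ∩ (g +ᵥ B)) t := by
  have hc : #(g +ᵥ B) = #B := card_vadd_finset g B
  have hU : #(B ∪ (g +ᵥ B)) + #(B ∩ (g +ᵥ B)) = #B + #B := by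
    rw [card_union_add_card_inter, hc]
  have hI : #(B ∩ (g +ᵥ B)) ≤ #B := card_le_card inter_subset_left
  have h1 := exc_le' (B := B ∩ (g +ᵥ B)) hA (by omega) hAt hg
  have h2 := exc_le' (B := B ∪ (g +ᵥ B)) hA (by omega) hAt (by omega)
  -- The counts for the intersection and the union are the outer ones of four with equal sums, so
  -- convexity of the positive part applies. Pollard's bounds for these two sets have the same total
  -- as those for B and its translate, so both are attained.
  have h3 : exc A B t + exc A (g +ᵥ B) t ≤ exc A (B ∩ (g +ᵥ B)) t + exc A (B ∪ (g +ᵥ B)) t := by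
    unfold exc
    rw [← sum_add_distrib, ← sum_add_distrib]
    refine sum_le_sum fun x _ => ?_
    have e1 := rep_union_add_rep_inter B (g +ᵥ B) A x
    have e2 := rep_mono_left (inter_subset_left (s₁ := B) (s₂ := g +ᵥ B)) A x
    have e3 := rep_mono_left (inter_subset_right (s₁ := B) (s₂ := g +ᵥ B)) A x
    simp only [rep_comm _ A] at e1 e2 e3
    omega
  rw [exc_vadd_right, h] at h3
  unfold Extremal
  refine le_antisymm h1 ?_
  have e : (#A - t) * (#(B ∪ (g +ᵥ B)) - t) + (#A - t) * (#(B ∩ (g +ᵥ B)) - t)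
      = (#A - t) * (#B - t) + (#A - t) * (#B - t) := by
    rw [← mul_add, ← mul_add]; congr 1; omega
  omega

theorem exc_eq_exc_succ_add (A B : Finset G) (t : ℕ) :
    exc A B t = exc A B (t + 1) + #{x | t < rep A B x} := by
  unfold exc
  rw [card_filter, ← sum_add_distrib]
  refine sum_congr rfl fun x _ => ?_
  split_ifs <;> omega

theorem sum_rep_eq_sum_rep_neg (A B W : Finset G) :
    ∑ x ∈ W, rep A B x = ∑ b ∈ B, rep W (-A) b := by
  simp_rw [rep_comm A B, rep, card_filter]
  rw [sum_comm]
  refine sum_congr rfl fun b _ => sum_congr rfl fun x _ => ?_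
  simp [mem_neg']

/-- Duality: the popular sums of an extremal pair form an extremal pair with the negative of
either summand. -/
theorem Extremal.dual {Q : ℕ} {A B W : Finset G} {t : ℕ} (h : Extremal A B t)
    (hA : LargeDiff Q A) (hQ : #W + #A ≤ Q) (hAt : t ≤ #A) (hBt : t ≤ #B)
    (hW1 : ∀ x, t < rep A B x → x ∈ W) (hW2 : ∀ x ∈ W, t ≤ rep A B x) (hW : #A - t ≤ #W) :
    Extremal W (-A) (#A - t) ∧ ∀ y, #A - t < rep W (-A) y → y ∈ B := by
  have hn : #(-A) = #A := card_neg A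
  have h1 := exc_le (A := W) (t := #A - t) hA.neg (by omega) hW (by omega)
  have h2 : ∑ x ∈ W, rep A B x = (#A - t) * (#B - t) + #W * t := by
    rw [← h, exc, ← sum_subset (subset_univ W), ← smul_eq_mul, ← sum_const, ← sum_add_distrib]
    · refine sum_congr rfl fun x hx => ?_
      have := hW2 x hx; omega
    · intro x _ hx
      by_contra hc
      exact hx (hW1 x (by omega))
  rw [sum_rep_eq_sum_rep_neg] at h2
  have h3 : ∑ b ∈ B, rep W (-A) b ≤ ∑ b ∈ B, (rep W (-A) b - (#A - t)) + #B * (#A - t) := by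
    rw [← smul_eq_mul, ← sum_const, ← sum_add_distrib]
    exact sum_le_sum fun x _ => by omega
  have h4 : ∑ b ∈ B, (rep W (-A) b - (#A - t)) + ∑ b ∈ Bᶜ, (rep W (-A) b - (#A - t))
      = exc W (-A) (#A - t) := by
    rw [exc, sum_add_sum_compl]
  obtain ⟨α, hα⟩ := Nat.exists_eq_add_of_le hAt
  obtain ⟨β, hβ⟩ := Nat.exists_eq_add_of_le hBt
  obtain ⟨w, hw⟩ := Nat.exists_eq_add_of_le hW
  rw [hn] at h1
  have e1 : #A - t = α := by omega
  have e2 : #B - t = β := by omega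
  have e3 : #W - α = w := by omega
  have e4 : #A - α = t := by omega
  unfold Extremal
  rw [hn]
  simp only [e1, e2, e3, e4] at h1 h2 h3 h4 hw ⊢
  rw [h2, hβ, hw] at h3
  -- Double counting shows that the part of the excess of (W, -A) over B already reaches Pollard's
  -- bound w * t. Hence the bound is attained and nothing is left outside B.
  have h5 : w * t + ∑ b ∈ Bᶜ, (rep W (-A) b - α) ≤ exc W (-A) α := by
    nlinarith
  refine ⟨by omega, fun y hy => ?_⟩
  by_contra hyB
  have h6 : ∑ b ∈ Bᶜ, (rep W (-A) b - α) = 0 := by omega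
  have := sum_eq_zero_iff.1 h6 y (by simpa using hyB)
  omega

/-- The popular sums are counted by the drop of the excess from level t to t + 1; the first value is
exact and Pollard bounds the second. -/
theorem Extremal.le_card_popular {Q : ℕ} {A B : Finset G} {t : ℕ} (h : Extremal A B t)
    (hB : LargeDiff Q B) (hQ : #A + #B ≤ Q) (hAt : t < #A) (hBt : t < #B) :
    #A + #B ≤ #{x | t < rep A B x} + 2 * t + 1 := by
  have h1 := exc_le (t := t + 1) hB hQ hAt hBt
  have h2 := exc_eq_exc_succ_add A B t
  rw [h] at h2
  obtain ⟨α, hα⟩ := Nat.exists_eq_add_of_lt hAt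
  obtain ⟨β, hβ⟩ := Nat.exists_eq_add_of_lt hBt
  rw [show #A - t = α + 1 by omega, show #B - t = β + 1 by omega] at h2
  rw [show #A - (t + 1) = α by omega, show #B - (t + 1) = β by omega] at h1
  nlinarith

end Basic

/-! ### Progressions and their propagation through an extremal pair -/

section Progressions

variable {G : Type*} [AddCommGroup G] [DecidableEq G]

/-- The progression `a, a + d, …, a + (n - 1) d`. -/
def ap (a d : G) (n : ℕ) : Finset G := (range n).image fun i : ℕ => a + i • d

/-- `A` is an arithmetic progression of difference `d`. -/
def IsAP (A : Finset G) (d : G) : Prop := ∃ a, A = ap a d #A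

theorem mem_ap {a d x : G} {n : ℕ} : x ∈ ap a d n ↔ ∃ i < n, a + i • d = x := by
  simp [ap]

theorem ap_subset_ap (a d : G) {m n : ℕ} (h : m ≤ n) : ap a d m ⊆ ap a d n :=
  image_subset_image (range_subset_range.2 h)

theorem card_ap (a : G) {d : G} {n : ℕ} (h : n ≤ addOrderOf d) : #(ap a d n) = n := by
  rw [ap, card_image_of_injOn, card_range]
  intro i hi j hj hij
  rw [coe_range, Set.mem_Iio] at hi hj
  exact nsmul_injOn_Iio_addOrderOf (Set.mem_Iio.2 (hi.trans_le h)) (Set.mem_Iio.2 (hj.trans_le h))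
    (add_left_cancel hij)

theorem nsmul_inj_of_lt {d : G} {i j : ℕ} (hi : i < addOrderOf d) (hj : j < addOrderOf d)
    (h : i • d = j • d) : i = j :=
  nsmul_injOn_Iio_addOrderOf (Set.mem_Iio.2 hi) (Set.mem_Iio.2 hj) h

theorem ap_succ (a d : G) (n : ℕ) : ap a d (n + 1) = insert (a + n • d) (ap a d n) := by
  rw [ap, range_add_one, image_insert, ap]

theorem ap_neg_diff (a d : G) (n : ℕ) : ap a d n = ap (a + (n - 1 : ℕ) • d) (-d) n := by
  ext x
  simp only [mem_ap]
  constructor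
  · rintro ⟨i, hi, rfl⟩
    refine ⟨n - 1 - i, by omega, ?_⟩
    rw [show n - 1 = i + (n - 1 - i) by omega, add_nsmul, Nat.add_sub_cancel_left, smul_neg]
    abel
  · rintro ⟨i, hi, rfl⟩
    refine ⟨n - 1 - i, by omega, ?_⟩
    conv_rhs => rw [show n - 1 = i + (n - 1 - i) by omega]
    rw [add_nsmul, smul_neg]
    abel

theorem IsAP.neg_diff {A : Finset G} {d : G} (h : IsAP A d) : IsAP A (-d) := by
  obtain ⟨a, ha⟩ := h
  exact ⟨_, ha.trans (ap_neg_diff a d _)⟩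

theorem isAP_neg_diff_iff {A : Finset G} {d : G} : IsAP A (-d) ↔ IsAP A d :=
  ⟨fun h => by simpa using h.neg_diff, IsAP.neg_diff⟩

theorem IsAP.of_neg {A : Finset G} {d : G} (h : IsAP (-A) d) : IsAP A d := by
  rw [← isAP_neg_diff_iff]
  obtain ⟨a, ha⟩ := h
  rw [card_neg] at ha
  refine ⟨-a, ?_⟩
  ext x
  rw [← neg_neg x, ← mem_neg', ha, mem_ap, mem_ap]
  constructor
  · rintro ⟨i, hi, h⟩
    refine ⟨i, hi, ?_⟩
    rw [← h, smul_neg]; abel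
  · rintro ⟨i, hi, h⟩
    refine ⟨i, hi, ?_⟩
    rw [← neg_inj, ← h, smul_neg]; abel

theorem isAP_pair {x y : G} (h : x ≠ y) : IsAP {x, y} (y - x) := by
  refine ⟨x, ?_⟩
  rw [card_pair h]
  ext z
  simp only [mem_insert, mem_singleton, mem_ap]
  constructor
  · rintro (rfl | rfl)
    · exact ⟨0, by simp⟩
    · exact ⟨1, by simp⟩
  · rintro ⟨i, hi, rfl⟩
    interval_cases i <;> simp

theorem le_addOrderOf_of_isAP {Q : ℕ} {A : Finset G} {d : G} (h : IsAP A d)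
    (hA : LargeDiff Q A) (h2 : 2 ≤ #A) : Q ≤ addOrderOf d := by
  obtain ⟨a, ha⟩ := h
  have h0 : a ∈ A := by rw [ha, mem_ap]; exact ⟨0, by omega, by simp⟩
  have h1 : a + d ∈ A := by rw [ha, mem_ap]; exact ⟨1, by omega, by simp⟩
  have hd : d ≠ 0 := by
    rintro rfl
    have : A ⊆ {a} := by
      intro x hx
      rw [ha, mem_ap] at hx
      obtain ⟨i, -, rfl⟩ := hx
      simp
    have := card_le_card this
    simp at this
    omega
  have := hA _ h1 _ h0 (by simpa using hd)
  simpa using this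

variable [Fintype G]

/-- A set which gains at most one element under translation by `d` is a progression. -/
theorem isAP_of_card_vadd_sdiff_le {X : Finset G} {d : G} (hX : #X < addOrderOf d)
    (h : #((d +ᵥ X) \ X) ≤ 1) : IsAP X d := by
  induction hn : #X generalizing X with
  | zero => exact ⟨0, by rw [hn, card_eq_zero.1 hn]; rfl⟩
  | succ n ih =>
    obtain ⟨x₀, hx₀⟩ := card_pos.1 (show 0 < #X by omega)
    -- This x is the only element whose successor leaves X. Once it is deleted, x itself is the only
    -- possible gain, so it continues the shorter progression.
    obtain ⟨x, hx, hxd⟩ : ∃ x ∈ X, x + d ∉ X := by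
      by_contra hc
      push Not at hc
      have := addOrderOf_le_card_of_closed hx₀ hc
      omega
    have hsub : ∀ y ∈ (d +ᵥ X.erase x) \ X.erase x, y = x := by
      intro y hy
      rw [mem_sdiff, mem_vadd_iff, mem_erase, mem_erase] at hy
      by_contra hyx
      have hyX : y ∉ X := fun h => hy.2 ⟨hyx, h⟩
      have h1 : y ∈ (d +ᵥ X) \ X := by
        rw [mem_sdiff, mem_vadd_iff]; exact ⟨hy.1.2, hyX⟩
      have h2 : x + d ∈ (d +ᵥ X) \ X := by
        rw [mem_sdiff, mem_vadd_iff]; simpa using ⟨hx, hxd⟩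
      have := card_le_one.1 h _ h1 _ h2
      exact hy.1.1 (by rw [this]; simp)
    have hc : #(X.erase x) = n := by rw [card_erase_of_mem hx, hn]; rfl
    obtain ⟨a, ha⟩ := ih (X := X.erase x) (by omega)
      (card_le_one.2 fun y hy z hz => (hsub y hy).trans (hsub z hz).symm) hc
    rw [hc] at ha
    have hXi : X = insert x (ap a d n) := by rw [← ha, insert_erase hx]
    rcases Nat.eq_zero_or_pos n with rfl | hpos
    · refine ⟨x, ?_⟩
      rw [hn, hXi]
      simp [ap]
    · refine ⟨a, ?_⟩
      rw [hn, ap_succ, hXi]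
      congr 1
      symm
      apply hsub
      rw [ha, mem_sdiff, mem_vadd_iff, mem_ap, mem_ap]
      refine ⟨⟨n - 1, by omega, ?_⟩, ?_⟩
      · conv_rhs => rw [show n = n - 1 + 1 by omega, succ_nsmul]
        abel
      · rintro ⟨i, hi, hid⟩
        have := nsmul_inj_of_lt (by omega) (by omega) (add_left_cancel hid)
        omega

theorem ap_inter_vadd (a : G) {d : G} {n : ℕ} (h : n + 2 ≤ addOrderOf d) :
    ap a d (n + 1) ∩ (d +ᵥ ap a d (n + 1)) = ap (a + d) d n := by
  ext x
  rw [mem_inter, mem_vadd_iff, mem_ap, mem_ap, mem_ap]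
  constructor
  · rintro ⟨⟨i, hi, rfl⟩, j, hj, hij⟩
    have e : i • d = (j + 1) • d := by
      rw [succ_nsmul]
      have : a + j • d + d = a + i • d := by rw [hij]; abel
      rw [add_assoc] at this
      exact (add_left_cancel this).symm
    have := nsmul_inj_of_lt (by omega) (by omega) e
    refine ⟨j, by omega, ?_⟩
    rw [e, succ_nsmul]; abel
  · rintro ⟨i, hi, rfl⟩
    refine ⟨⟨i + 1, by omega, ?_⟩, i, by omega, ?_⟩
    · rw [succ_nsmul]; abel
    · abel

/-- The Cauchy-Davenport inequality. -/
theorem card_add_card_le_of_forall_add_mem {Q : ℕ} {X Y Z : Finset G} (hY : LargeDiff Q Y)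
    (hQ : #X + #Y ≤ Q) (hX0 : X.Nonempty) (hY0 : Y.Nonempty)
    (h : ∀ x ∈ X, ∀ y ∈ Y, x + y ∈ Z) : #X + #Y ≤ #Z + 1 := by
  have hx := card_pos.2 hX0
  have hy := card_pos.2 hY0
  have h0 : Extremal X Y 0 := by simp [Extremal, exc, sum_rep]
  have h1 := h0.le_card_popular hY hQ hx hy
  have h2 : #{x | 0 < rep X Y x} ≤ #Z := by
    refine card_le_card fun z hz => ?_
    rw [mem_filter, rep_pos_iff] at hz
    obtain ⟨-, a, ha, b, hb, rfl⟩ := hz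
    exact h a ha b hb
  omega

/-- If one member of an extremal pair is a progression, then so is the other. -/
theorem Extremal.isAP {Q : ℕ} {A B : Finset G} {t : ℕ} {d : G} (h : Extremal A B t)
    (hA : LargeDiff Q A) (hB : LargeDiff Q B) (hQ : #A + 2 * #B ≤ Q)
    (hQ' : 2 * #A + #B ≤ Q) (ht : 1 ≤ t)
    (hAt : t < #A) (hBt : t < #B) (hd : IsAP B d) : IsAP A d := by
  have hord : Q ≤ addOrderOf d := le_addOrderOf_of_isAP hd hB (by omega)
  have hshort : ∀ n, t + 1 ≤ n → n ≤ #B → ∀ b, Extremal A (ap b d n) t → ap b d n ⊆ B →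
      ∃ b', Extremal A (ap b' d (t + 1)) t ∧ ap b' d (t + 1) ⊆ B := by
    intro n hn
    induction n, hn using Nat.le_induction with
    | base => exact fun _ b hb hs => ⟨b, hb, hs⟩
    | succ n hn ih =>
      intro hnB b hb hs
      have hI := ap_inter_vadd b (d := d) (n := n) (by omega)
      have hcard : #(ap b d (n + 1)) = n + 1 := card_ap b (by omega)
      refine ih (by omega) (b + d) ?_ ?_
      · rw [← hI]
        refine hb.inter_vadd hA (by omega) hAt.le d ?_
        rw [hI, card_ap _ (by omega)]; omega
      · rw [← hI]; exact inter_subset_left.trans hs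
  obtain ⟨b₀, hb₀⟩ := hd
  -- Each intersection with the translate by d removes one term. At length t + 1 the excess merely
  -- counts the points with all t + 1 representations.
  obtain ⟨b, hb, hbB⟩ := hshort #B hBt le_rfl b₀ (by rwa [← hb₀]) (by rw [← hb₀])
  have hcB : #(ap b d (t + 1)) = t + 1 := card_ap b (by omega)
  set X : Finset G := univ.filter fun x => t < rep A (ap b d (t + 1)) x with hXdef
  have hXc : #X = #A - t := by
    have h1 := exc_eq_exc_succ_add A (ap b d (t + 1)) t
    have h2 : exc A (ap b d (t + 1)) (t + 1) = 0 := by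
      refine sum_eq_zero fun x _ => ?_
      have := rep_le_card_right A (ap b d (t + 1)) x
      omega
    rw [hb, h2, hcB, Nat.add_sub_cancel_left, mul_one] at h1
    change _ = 0 + #X at h1
    omega
  have hXA : ∀ x ∈ X, ∀ i ≤ t, x - (b + i • d) ∈ A := by
    intro x hx i hi
    rw [hXdef, mem_filter, rep_comm, rep] at hx
    have : filter (fun a => x - a ∈ A) (ap b d (t + 1)) = ap b d (t + 1) :=
      eq_of_subset_of_card_le (filter_subset _ _) (by omega)
    have hm : b + i • d ∈ ap b d (t + 1) := mem_ap.2 ⟨i, by omega, rfl⟩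
    rw [← this, mem_filter] at hm
    exact hm.2
  have hX0 : X.Nonempty := card_pos.1 (by omega)
  have hsubt : ap b d t ⊆ B := (ap_subset_ap b d (by omega)).trans hbB
  have hct : #(-ap b d t) = t := by rw [card_neg, card_ap _ (by omega)]
  have hcU : #(X ∪ (-d +ᵥ X)) ≤ #X + #X := by
    refine (card_union_le _ _).trans ?_
    rw [card_vadd_finset]
  -- Subtracting the first t terms from X or from X - d stays inside A, and |A| = |X| + t.
  -- Cauchy-Davenport then allows X - d only one new element.
  have hCD := card_add_card_le_of_forall_add_mem (X := X ∪ (-d +ᵥ X)) (Y := -ap b d t) (Z := A)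
    ((hB.mono hsubt).neg) (by omega) (hX0.mono subset_union_left) (card_pos.1 (by omega))
    (by
      intro x hx y hy
      rw [mem_neg', mem_ap] at hy
      obtain ⟨i, hi, hiy⟩ := hy
      rw [mem_union, mem_vadd_iff] at hx
      rcases hx with hx | hx
      · have := hXA x hx i hi.le
        rwa [hiy, sub_neg_eq_add] at this
      · have := hXA _ hx (i + 1) (by omega)
        rw [succ_nsmul, ← add_assoc, hiy] at this
        convert this using 1; abel)
  have hsd : #((-d +ᵥ X) \ X) ≤ 1 := by
    have : #((-d +ᵥ X) \ X) + #X = #(X ∪ (-d +ᵥ X)) := by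
      rw [union_comm, card_sdiff_add_card]
    omega
  obtain ⟨x, hx⟩ := isAP_of_card_vadd_sdiff_le (d := -d) (by rw [addOrderOf_neg]; omega) hsd
  rw [← isAP_neg_diff_iff]
  refine ⟨x - b, (eq_of_subset_of_card_le ?_ ?_).symm⟩
  · intro y hy
    rw [mem_ap] at hy
    obtain ⟨k, hk, rfl⟩ := hy
    have hxj : ∀ j < #X, x + j • (-d) ∈ X := fun j hj => by
      rw [hx]; exact mem_ap.2 ⟨j, hj, rfl⟩
    obtain ⟨j, i, hj, hi, rfl⟩ : ∃ j i, j < #X ∧ i ≤ t ∧ k = j + i := by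
      rcases le_or_gt k t with hkt | hkt
      · exact ⟨0, k, by omega, hkt, by omega⟩
      · exact ⟨k - t, t, by omega, le_rfl, by omega⟩
    have := hXA _ (hxj j hj) i hi
    convert this using 1
    rw [add_nsmul, smul_neg, smul_neg]; abel
  · rw [card_ap _ (by rw [addOrderOf_neg]; omega)]

end Progressions

/-! ### Additive energy and the equality case of Pollard's inequality -/

section Equality

variable {G : Type*} [AddCommGroup G] [DecidableEq G] [Fintype G]

theorem rep_neg_self (A : Finset G) (g : G) : rep A (-A) g = #(A ∩ (g +ᵥ A)) := by
  unfold rep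
  congr 1; ext a
  simp [mem_vadd_iff, mem_neg']

theorem rep_neg_self_zero (A : Finset G) : rep A (-A) 0 = #A := by
  rw [rep_neg_self, zero_vadd, inter_self]

theorem sum_rep_neg_self_mul (A : Finset G) (f : G → ℕ) :
    ∑ g, rep A (-A) g * f g = ∑ a ∈ A, ∑ b ∈ A, f (a - b) := by
  simp_rw [rep, card_filter, sum_mul]
  rw [sum_comm]
  refine sum_congr rfl fun a _ => ?_
  have : ∀ g : G, (if g - a ∈ -A then 1 else 0) * f g = if a - g ∈ A then f g else 0 := by
    intro g; simp [mem_neg']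
  simp_rw [this]
  rw [← sum_filter]
  refine sum_bij' (fun g _ => a - g) (fun b _ => a - b) ?_ ?_ ?_ ?_ ?_ <;> simp

/-- The additive energy, counted through sums and through differences. -/
theorem sum_rep_sq (A B : Finset G) :
    ∑ x, rep A B x ^ 2 = ∑ g, rep A (-A) g * rep B (-B) g := by
  rw [sum_rep_neg_self_mul, sum_comm]
  have h1 : ∀ f : G → ℕ, ∑ x, rep A B x * f x = ∑ a ∈ A, ∑ b ∈ B, f (a + b) := by
    intro f
    simp_rw [rep, card_filter, sum_mul]
    rw [sum_comm]
    refine sum_congr rfl fun a _ => ?_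
    simp_rw [ite_mul, one_mul, zero_mul]
    rw [← sum_filter]
    refine sum_bij' (fun g _ => g - a) (fun b _ => a + b) ?_ ?_ ?_ ?_ ?_ <;> simp
  simp_rw [sq, h1]
  refine sum_congr rfl fun a _ => ?_
  simp_rw [rep, card_filter]
  rw [sum_comm]
  refine sum_congr rfl fun a' _ => sum_congr rfl fun b _ => ?_
  congr 1
  simp only [mem_neg', eq_iff_iff]
  constructor <;> intro h <;> convert h using 1 <;> abel

/-- The energy is computed through differences; the middle sum records how far each g ≠ 0 stays
below the permitted t. -/
theorem sum_rep_sq_add {A B : Finset G} {t : ℕ} (h : ∀ g ≠ 0, rep B (-B) g ≤ t) :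
    ∑ x, rep A B x ^ 2 + ∑ g ∈ univ.erase 0, rep A (-A) g * (t - rep B (-B) g) + t * #A
      = #A * #B + t * (#A * #A) := by
  rw [sum_rep_sq, ← add_sum_erase univ _ (mem_univ (0 : G)), rep_neg_self_zero, rep_neg_self_zero,
    add_assoc, add_assoc, ← add_assoc (∑ x ∈ univ.erase 0, _), ← sum_add_distrib]
  have h1 : ∑ g ∈ univ.erase (0 : G), (rep A (-A) g * rep B (-B) g
      + rep A (-A) g * (t - rep B (-B) g)) = t * ∑ g ∈ univ.erase (0 : G), rep A (-A) g := by
    rw [mul_sum]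
    refine sum_congr rfl fun g hg => ?_
    rw [← mul_add, Nat.add_sub_cancel' (h g (ne_of_mem_erase hg)), mul_comm]
  have h2 : ∑ g ∈ univ.erase (0 : G), rep A (-A) g + #A = #A * #A := by
    have := sum_rep A (-A)
    rw [card_neg, ← add_sum_erase univ _ (mem_univ (0 : G)), rep_neg_self_zero] at this
    omega
  rw [h1, ← mul_add, h2]

/-- For r = t + w this is (t - w)(t - w - 1) ≥ 0 pointwise, sharp at r = 2t and r = 2t - 1. -/
theorem card_mul_card_add_le_energy (A B : Finset G) (t : ℕ) :
    #A * #B + 4 * t * exc A B t ≤ ∑ x, rep A B x ^ 2 + 2 * exc A B t := by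
  rw [← sum_rep, exc, mul_sum, mul_sum, ← sum_add_distrib, ← sum_add_distrib]
  refine sum_le_sum fun z _ => ?_
  rcases le_total (rep A B z) t with hr | hr
  · rw [Nat.sub_eq_zero_of_le hr]
    have := Nat.le_self_pow (two_ne_zero) (rep A B z)
    omega
  · obtain ⟨w, hw⟩ := Nat.exists_eq_add_of_le hr
    rw [hw, Nat.add_sub_cancel_left]
    rcases le_or_gt t w with h1 | h1
    · obtain ⟨v, rfl⟩ := Nat.exists_eq_add_of_le h1
      nlinarith [Nat.zero_le v]
    · obtain ⟨v, rfl⟩ := Nat.exists_eq_add_of_lt h1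
      nlinarith [Nat.zero_le v]

/-- The neighbouring chord of the square: with τ = 1 + s and r = τ + w > τ it is (τ - w - 1)(τ - w -
2) ≥ 0 pointwise. -/
theorem card_mul_card_add_popular_le_energy (A B : Finset G) (s : ℕ) :
    #A * #B + 4 * (1 + s) * exc A B (1 + s) + 2 * (1 + s) * #{x | 1 + s < rep A B x}
      ≤ ∑ x, rep A B x ^ 2 + 4 * exc A B (1 + s) + 2 * #{x | 1 + s < rep A B x} := by
  rw [← sum_rep, exc, mul_sum, mul_sum, card_filter, mul_sum, mul_sum,
    ← sum_add_distrib, ← sum_add_distrib, ← sum_add_distrib, ← sum_add_distrib]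
  refine sum_le_sum fun z _ => ?_
  split_ifs with hr
  · obtain ⟨w, hw⟩ := Nat.exists_eq_add_of_le hr.le
    rw [hw, Nat.add_sub_cancel_left]
    rcases le_or_gt s w with h1 | h1
    · obtain ⟨v, rfl⟩ := Nat.exists_eq_add_of_le h1
      nlinarith [Nat.zero_le v]
    · obtain ⟨v, rfl⟩ := Nat.exists_eq_add_of_lt h1
      nlinarith [Nat.zero_le v]
  · rw [Nat.sub_eq_zero_of_le (by omega)]
    have := Nat.le_self_pow (two_ne_zero) (rep A B z)
    omega

/-- The upper and lower estimates of the energy meet exactly at |A| = |B| = 2t, which forces the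
sizes and makes the loss `K` vanish. For t ≥ 3 the second chord, together with at least 2t - 1
popular sums, contradicts the upper estimate. -/
theorem Extremal.irreducible_cases {Q : ℕ} {A B : Finset G} {t : ℕ} (h : Extremal A B t)
    (hB : LargeDiff Q B) (hQ : #A + #B ≤ Q) (ht : 1 ≤ t) (hAt : 2 * t ≤ #A) (hAB : #A ≤ #B)
    (hirr : ∀ g ≠ 0, rep B (-B) g ≤ t) :
    #A = 2 * t ∧ #B = 2 * t ∧ (t = 1 ∨ t = 2 ∧ ∀ g ≠ 0, 0 < rep A (-A) g → rep B (-B) g = 2) := by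
  have hE := sum_rep_sq_add (A := A) hirr
  set K := ∑ g ∈ univ.erase 0, rep A (-A) g * (t - rep B (-B) g) with hK
  set E := ∑ x, rep A B x ^ 2 with hEdef
  obtain ⟨x, hx⟩ := Nat.exists_eq_add_of_le hAt
  obtain ⟨y, hy⟩ := Nat.exists_eq_add_of_le hAB
  have hα : #A - t = t + x := by omega
  have hβ : #B - t = t + x + y := by omega
  have hex : exc A B t = (t + x) * (t + x + y) := by rw [h, hα, hβ]
  have low := card_mul_card_add_le_energy A B t
  rw [← hEdef] at low
  rw [hex, hx] at low
  rw [hx] at hE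
  rw [hx] at hy
  rw [hy] at low hE
  obtain ⟨s, rfl⟩ := Nat.exists_eq_add_of_le ht
  have hx0 : x = 0 := by
    by_contra hne
    obtain ⟨v, rfl⟩ := Nat.exists_eq_succ_of_ne_zero hne
    simp only [Nat.succ_eq_add_one] at *
    ring_nf at low hE
    nlinarith [Nat.zero_le (v * s), Nat.zero_le (v * v * s), Nat.zero_le (y * v * s),
      Nat.zero_le (y * v), Nat.zero_le (y * s), Nat.zero_le (s * s), Nat.zero_le (v * s * s),
      Nat.zero_le (y * s * s), Nat.zero_le (v * v)]
  subst hx0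
  have hy0 : y = 0 := by
    by_contra hne
    obtain ⟨v, rfl⟩ := Nat.exists_eq_succ_of_ne_zero hne
    simp only [Nat.succ_eq_add_one] at *
    ring_nf at low hE
    nlinarith [Nat.zero_le (v * s), Nat.zero_le (s * s), Nat.zero_le (v * s * s)]
  subst hy0
  refine ⟨by omega, by omega, ?_⟩
  rcases Nat.lt_or_ge s 2 with hs | hs
  · interval_cases s
    · left; rfl
    · right
      refine ⟨rfl, fun g hg hpos => ?_⟩
      have hK0 : K = 0 := by omega
      rw [hK] at hK0
      have h1 := sum_eq_zero_iff.1 hK0 g (mem_erase.2 ⟨hg, mem_univ g⟩)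
      have h2 := hirr g hg
      rcases Nat.mul_eq_zero.1 h1 with h3 | h3 <;> omega
  · exfalso
    have hT := h.le_card_popular hB hQ (by omega) (by omega)
    have low2 := card_mul_card_add_popular_le_energy A B s
    rw [← hEdef] at low2
    rw [hex, hx] at low2
    rw [hx] at hT
    rw [hy] at low2 hT
    obtain ⟨v, hv⟩ := Nat.exists_eq_add_of_le hs
    generalize #{x | 1 + s < rep A B x} = T at *
    have hT' : 2 * s + 1 ≤ T := by omega
    have h3 : 2 * s * (2 * s + 1) ≤ 2 * s * T := Nat.mul_le_mul_left _ hT'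
    subst hv
    clear * - low2 hE h3
    ring_nf at low2 hE h3
    nlinarith [Nat.zero_le v, Nat.zero_le (v * v)]

/-- The equality case of Pollard's inequality. -/
theorem Extremal.exists_isAP {Q M t : ℕ} (hM : 3 * M ≤ Q) (ht : 1 ≤ t) {A B : Finset G}
    (hA : LargeDiff Q A) (hB : LargeDiff Q B) (hAM : #A ≤ M) (hBM : #B ≤ M)
    (hAt : 2 * t ≤ #A) (hBt : 2 * t ≤ #B)
    (hT : 2 ≤ t → LargeDiff Q {x | t < rep A B x} ∧ #{x | t < rep A B x} ≤ M)
    (h : Extremal A B t) : ∃ d, IsAP A d ∧ IsAP B d := by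
  induction t using Nat.strong_induction_on generalizing A B with
  | _ t iht =>
  induction hn : #A + #B using Nat.strong_induction_on generalizing A B with
  | _ n ihn =>
  -- If B meets a translate in more than t points, the intersection is a smaller extremal partner of
  -- A. Should it have fewer than 2t elements, duality moves to the level |B'| - t < t instead.
  have reduce : ∀ A B : Finset G, LargeDiff Q A → LargeDiff Q B → #A ≤ M → #B ≤ M →
      2 * t ≤ #A → 2 * t ≤ #B →
      (2 ≤ t → LargeDiff Q {x | t < rep A B x} ∧ #{x | t < rep A B x} ≤ M) →
      Extremal A B t → #A + #B = n → (∃ g ≠ 0, t < rep B (-B) g) →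
      ∃ d, IsAP A d ∧ IsAP B d := by
    clear h hT hAt hBt hAM hBM hA hB hn A B
    rintro A B hA hB hAM hBM hAt hBt hT h hn ⟨g, hg, hgt⟩
    rw [rep_neg_self] at hgt
    set B' := B ∩ (g +ᵥ B) with hB'
    have hsub : B' ⊆ B := inter_subset_left
    have hlt : #B' < #B := by
      refine card_lt_card (ssubset_of_subset_of_ne hsub fun heq => ?_)
      obtain ⟨b, hb⟩ := card_pos.1 (show 0 < #B by omega)
      have hcl : ∀ x ∈ B, x + -g ∈ B := by
        intro x hx
        rw [← heq, hB', mem_inter, mem_vadd_iff] at hx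
        rw [← sub_eq_add_neg]; exact hx.2
      have h1 := addOrderOf_le_card_of_closed hb hcl
      have h2 := hB _ (hcl b hb) b hb (by simpa using hg)
      rw [add_sub_cancel_left] at h2
      omega
    have h' : Extremal A B' t := h.inter_vadd hA (by omega) (by omega) g hgt.le
    have hTsub : univ.filter (fun x => t < rep A B' x) ⊆ univ.filter (fun x => t < rep A B x) :=
      monotone_filter_right _ fun x _ hx => hx.trans_le (rep_mono_right A hsub x)
    have hfin : ∀ d, IsAP A d → ∃ d, IsAP A d ∧ IsAP B d := fun d hd =>
      ⟨d, hd, h.symm.isAP hB hA (by omega) (by omega) ht (by omega) (by omega) hd⟩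
    rcases le_or_gt (2 * t) #B' with h2 | h2
    · obtain ⟨d, hd, -⟩ := ihn (#A + #B') (by omega) hA (hB.mono hsub) hAM (by omega) hAt h2
        (fun ht2 => ⟨(hT ht2).1.mono hTsub, (card_le_card hTsub).trans (hT ht2).2⟩) h' rfl
      exact hfin d hd
    · have ht2 : 2 ≤ t := by omega
      set W := univ.filter (fun x => t < rep A B' x) with hW
      have hWM : #W ≤ M := (card_le_card hTsub).trans (hT ht2).2
      have hWc : #A + #B' ≤ #W + 2 * t + 1 :=
        h'.le_card_popular (hB.mono hsub) (by omega) (by omega) hgt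
      obtain ⟨hd1, hd2⟩ := h'.symm.dual (W := W) (hB.mono hsub) (by omega) hgt.le (by omega)
        (fun x hx => by rw [hW, mem_filter, rep_comm]; exact ⟨mem_univ x, hx⟩)
        (fun x hx => by rw [hW, mem_filter, rep_comm] at hx; exact hx.2.le) (by omega)
      -- The popular sums of the dual pair lie in A, which supplies the hypothesis on popular sums
      -- at the lower level.
      have hsubA : univ.filter (fun y => #B' - t < rep W (-B') y) ⊆ A := fun y hy =>
        hd2 y (mem_filter.1 hy).2
      have hc : #(-B') = #B' := card_neg B'
      obtain ⟨d, -, hd⟩ := iht (#B' - t) (by omega) (by omega) (A := W) (B := -B')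
        ((hT ht2).1.mono hTsub) (hB.mono hsub).neg hWM (by omega) (by omega) (by omega)
        (fun _ => ⟨hA.mono hsubA, (card_le_card hsubA).trans hAM⟩) hd1
      exact hfin d (h'.isAP hA (hB.mono hsub) (by omega) (by omega) ht (by omega) hgt hd.of_neg)
  by_cases hrB : ∃ g ≠ 0, t < rep B (-B) g
  · exact reduce A B hA hB hAM hBM hAt hBt hT h hn hrB
  by_cases hrA : ∃ g ≠ 0, t < rep A (-A) g
  · obtain ⟨d, h1, h2⟩ := reduce B A hB hA hBM hAM hBt hAt
      (fun ht2 => by simpa only [rep_comm B A] using hT ht2) h.symm (by omega) hrA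
    exact ⟨d, h2, h1⟩
  push Not at hrA hrB
  have hcases : #A = 2 * t ∧ #B = 2 * t ∧
      (t = 1 ∨ t = 2 ∧ ∀ g ≠ 0, 0 < rep A (-A) g → rep A (-A) g = 2) := by
    rcases le_total #A #B with hAB | hAB
    · obtain ⟨h1, h2, h3⟩ := h.irreducible_cases hB (by omega) ht hAt hAB hrB
      obtain ⟨-, -, h4⟩ := h.symm.irreducible_cases hA (by omega) ht hBt (by omega) hrA
      refine ⟨h1, h2, ?_⟩
      rcases h3 with h3 | ⟨h3, h5⟩
      · exact Or.inl h3
      · rcases h4 with h4 | ⟨h4, h6⟩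
        · exact Or.inl h4
        · exact Or.inr ⟨h3, fun g hg hp => h6 g hg (by rw [h5 g hg hp]; norm_num)⟩
    · obtain ⟨h1, h2, h3⟩ := h.symm.irreducible_cases hA (by omega) ht hBt hAB hrA
      obtain ⟨-, -, h4⟩ := h.irreducible_cases hB (by omega) ht hAt (by omega) hrB
      refine ⟨h2, h1, ?_⟩
      rcases h3 with h3 | ⟨h3, h5⟩
      · exact Or.inl h3
      · rcases h4 with h4 | ⟨h4, h6⟩
        · exact Or.inl h4
        · exact Or.inr ⟨h3, fun g hg hp => h5 g hg (by rw [h6 g hg hp]; norm_num)⟩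
  obtain ⟨hA2, hB2, rfl | ⟨rfl, htwo⟩⟩ := hcases
  · obtain ⟨x, y, hxy, rfl⟩ := card_eq_two.1 hB2
    exact ⟨y - x, h.isAP hA hB (by omega) (by omega) le_rfl (by omega) (by omega) (isAP_pair hxy),
      isAP_pair hxy⟩
  · exfalso
    -- The 12 nonzero differences of the four-element set A form six values taken twice, so the
    -- excess at level 1 is 3 + 6 = 3 · 3. But a four-term progression represents its own difference
    -- three times, which is too often.
    have hext : Extremal A (-A) 1 := by
      have h1 : ∑ g ∈ univ.erase (0 : G), rep A (-A) g = 12 := by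
        have := sum_rep A (-A)
        rw [card_neg, ← add_sum_erase univ _ (mem_univ (0 : G)), rep_neg_self_zero, hA2] at this
        omega
      have h2 : 2 * ∑ g ∈ univ.erase (0 : G), (rep A (-A) g - 1)
          = ∑ g ∈ univ.erase (0 : G), rep A (-A) g := by
        rw [mul_sum]
        refine sum_congr rfl fun g hg => ?_
        rcases Nat.eq_zero_or_pos (rep A (-A) g) with h0 | h0
        · simp [h0]
        · simp [htwo g (ne_of_mem_erase hg) h0]
      rw [Extremal, exc, ← add_sum_erase univ _ (mem_univ (0 : G)), rep_neg_self_zero, card_neg,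
        hA2]
      omega
    obtain ⟨d, hd, -⟩ := iht 1 (by omega) le_rfl hA hA.neg hAM (by rw [card_neg]; exact hAM)
      (by omega) (by rw [card_neg]; omega) (by omega) hext
    have hord := le_addOrderOf_of_isAP hd hA (by omega)
    have hd0 : d ≠ 0 := by
      rintro rfl
      rw [addOrderOf_zero] at hord
      omega
    have h3 := hrA d hd0
    obtain ⟨a, ha⟩ := hd
    rw [hA2] at ha
    rw [rep_neg_self, ha, ap_inter_vadd a (by omega), card_ap _ (by omega)] at h3
    omega

end Equality

/-! ### Centred progressions and sums falling in a prescribed set -/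

section Centred

variable {G : Type*} [AddCommGroup G] [DecidableEq G]

/-- Only a lower bound, since sums may wrap around when the order of d is small. -/
theorem rep_ap_ge (x y : G) {d : G} {n : ℕ} (hn : n ≤ addOrderOf d) (k : ℕ) :
    min (k + 1) (2 * n - 1 - k) ≤ rep (ap x d n) (ap y d n) (x + y + k • d) := by
  have h1 : min (k + 1) (2 * n - 1 - k) ≤ #(Icc (k + 1 - n) (min k (n - 1))) := by
    rw [Nat.card_Icc]; omega
  refine h1.trans ?_
  refine card_le_card_of_injOn (fun i => x + i • d) ?_ ?_
  · intro i hi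
    rw [coe_Icc, Set.mem_Icc] at hi
    rw [mem_coe, mem_filter]
    by_cases hn0 : n = 0
    · omega
    refine ⟨mem_ap.2 ⟨i, by omega, rfl⟩, mem_ap.2 ⟨k - i, by omega, ?_⟩⟩
    change y + (k - i) • d = x + y + k • d - (x + i • d)
    rw [show k • d = (k - i) • d + i • d by rw [← add_nsmul]; congr 1; omega]
    abel
  · intro i hi j hj hij
    rw [coe_Icc, Set.mem_Icc] at hi hj
    by_cases hn0 : n = 0
    · omega
    exact nsmul_inj_of_lt (by omega) (by omega) (add_left_cancel hij)

theorem sum_range_min (n : ℕ) : ∑ k ∈ range (2 * n - 1), min (k + 1) (2 * n - 1 - k) = n ^ 2 := by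
  induction n with
  | zero => simp
  | succ n ih =>
    rcases Nat.eq_zero_or_pos n with rfl | hn
    · simp
    rw [show 2 * (n + 1) - 1 = (2 * n - 1) + 1 + 1 by omega, sum_range_succ, sum_range_succ']
    have : ∀ k ∈ range (2 * n - 1), min (k + 1 + 1) (2 * n - 1 + 1 + 1 - (k + 1))
        = min (k + 1) (2 * n - 1 - k) + 1 := by
      intro k hk
      rw [mem_range] at hk
      omega
    rw [sum_congr rfl this, sum_add_distrib, ih]
    simp only [sum_const, card_range, smul_eq_mul, mul_one]
    have e : (n + 1) ^ 2 = n ^ 2 + 2 * n + 1 := by ring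
    rw [e]
    omega

theorem sum_ap {d : G} {n : ℕ} (hn : n ≤ addOrderOf d) (a : G) {M : Type*} [AddCommMonoid M]
    (f : G → M) : ∑ x ∈ ap a d n, f x = ∑ i ∈ range n, f (a + i • d) := by
  rw [ap, sum_image]
  intro i hi j hj hij
  rw [coe_range, Set.mem_Iio] at hi hj
  exact nsmul_inj_of_lt (by omega) (by omega) (add_left_cancel hij)

theorem sq_le_sum_rep_ap (x y : G) {d : G} {n t : ℕ} (hn : 2 * n ≤ addOrderOf d) :
    (n - t) ^ 2 ≤ ∑ z ∈ ap (x + y + t • d) d (2 * (n - t) - 1),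
      (rep (ap x d n) (ap y d n) z - t) := by
  rw [sum_ap (by omega), ← sum_range_min]
  refine sum_le_sum fun j hj => ?_
  rw [mem_range] at hj
  have := rep_ap_ge x y (d := d) (n := n) (by omega) (t + j)
  rw [add_nsmul, ← add_assoc] at this
  omega

theorem sq_le_exc_ap [Fintype G] (x y : G) {d : G} {n t : ℕ} (hn : 2 * n ≤ addOrderOf d) :
    (n - t) ^ 2 ≤ exc (ap x d n) (ap y d n) t :=
  (sq_le_sum_rep_ap x y hn).trans (sum_le_univ_sum_of_nonneg fun _ => Nat.zero_le _)

/-- The progression of length `2h + 1` centred at `c`. -/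
def cap (c d : G) (h : ℕ) : Finset G := ap (c - h • d) d (2 * h + 1)

theorem ap_eq_cap (a d : G) (h : ℕ) : ap a d (2 * h + 1) = cap (a + h • d) d h := by
  rw [cap, add_sub_cancel_right]

theorem cap_neg_diff (c d : G) (h : ℕ) : cap c (-d) h = cap c d h := by
  rw [cap, cap, ap_neg_diff (c - h • d)]
  congr 1
  rw [Nat.add_sub_cancel, two_mul, add_nsmul, smul_neg]; abel

theorem IsAP.exists_cap {S : Finset G} {d : G} {h : ℕ} (hS : IsAP S d) (hc : #S = 2 * h + 1) :
    ∃ c, S = cap c d h := by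
  obtain ⟨a, ha⟩ := hS
  rw [hc, ap_eq_cap] at ha
  exact ⟨_, ha⟩

theorem isAP_cap {S : Finset G} {c d : G} {h : ℕ} (hc : #S = 2 * h + 1) (hS : S = cap c d h) :
    IsAP S d := ⟨_, by rw [hc]; exact hS⟩

theorem mem_cap_self (c d : G) (h : ℕ) : c ∈ cap c d h :=
  mem_ap.2 ⟨h, by omega, by abel⟩

theorem sum_cap {d : G} {h : ℕ} (hd : 2 * h + 1 ≤ addOrderOf d) (c : G) :
    ∑ x ∈ cap c d h, x = (2 * h + 1) • c := by
  rw [cap, sum_ap hd]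
  rw [sum_add_distrib, sum_const, card_range, ← sum_smul]
  have : ∑ i ∈ range (2 * h + 1), i = (2 * h + 1) * h := by
    rw [sum_range_id, Nat.add_sub_cancel, mul_comm 2 h, ← mul_assoc]
    exact Nat.mul_div_cancel _ two_pos
  rw [this, mul_nsmul', smul_sub, smul_smul, mul_nsmul']
  abel

/-- The sum of the elements is 2h + 1 times the centre, whatever the difference. Both centres lie in
S, so 2h + 1 < Q cannot annihilate their difference. -/
theorem cap_center_unique {Q h : ℕ} {S : Finset G} {c c' d d' : G} (hS : LargeDiff Q S)
    (hQ : 2 * h + 1 < Q) (hh : 1 ≤ h) (hc : #S = 2 * h + 1) (h1 : S = cap c d h)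
    (h2 : S = cap c' d' h) : c = c' := by
  have o1 := le_addOrderOf_of_isAP (isAP_cap hc h1) hS (by omega)
  have o2 := le_addOrderOf_of_isAP (isAP_cap hc h2) hS (by omega)
  have e : (2 * h + 1) • c = (2 * h + 1) • c' := by
    rw [← sum_cap (d := d) (by omega), ← sum_cap (d := d') (by omega), ← h1, ← h2]
  by_contra hne
  have o3 := hS c (h1 ▸ mem_cap_self c d h) c' (h2 ▸ mem_cap_self c' d' h) hne
  have : (2 * h + 1) • (c - c') = 0 := by rw [smul_sub, e, sub_self]
  have := addOrderOf_le_of_nsmul_eq_zero (by omega) this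
  omega

/-- A shift by two or more steps loses two terms at one end; if both end terms are missing, these
are already two. -/
theorem ap_shift {d x y : G} {n : ℕ} (hn : 2 ≤ n) (hd : 2 * n ≤ addOrderOf d)
    (h : #(ap x d n \ ap y d n) ≤ 1) : x = y ∨ x = y + d ∨ x = y - d := by
  have hx : ∀ i < n, x + i • d ∈ ap x d n := fun i hi => mem_ap.2 ⟨i, hi, rfl⟩
  have hnot : ∀ i j, i < n → j < n → i ≠ j → x + i • d ∉ ap y d n → x + j • d ∉ ap y d n →
      False := by
    intro i j hi hj hij h1 h2
    have := card_le_one.1 h _ (mem_sdiff.2 ⟨hx i hi, h1⟩) _ (mem_sdiff.2 ⟨hx j hj, h2⟩)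
    exact hij (nsmul_inj_of_lt (by omega) (by omega) (add_left_cancel this))
  by_cases h0 : x + 0 • d ∈ ap y d n
  · rw [zero_nsmul, add_zero, mem_ap] at h0
    obtain ⟨i, hi, rfl⟩ := h0
    rcases Nat.lt_or_ge i 2 with hi2 | hi2
    · interval_cases i <;> simp
    · exfalso
      have key : ∀ j, n ≤ i + j → j < n → y + i • d + j • d ∉ ap y d n := by
        intro j hj hjn hm
        rw [add_assoc, ← add_nsmul, mem_ap] at hm
        obtain ⟨k, hk, hkj⟩ := hm
        have := nsmul_inj_of_lt (by omega) (by omega) (add_left_cancel hkj)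
        omega
      exact hnot (n - 1) (n - 2) (by omega) (by omega) (by omega) (key _ (by omega) (by omega))
        (key _ (by omega) (by omega))
  · by_cases hl : x + (n - 1) • d ∈ ap y d n
    · rw [mem_ap] at hl
      obtain ⟨i, hi, hil⟩ := hl
      have hy : y = x + (n - 1 - i) • d := by
        have : (n - 1) • d = (n - 1 - i) • d + i • d := by rw [← add_nsmul]; congr 1; omega
        rw [this, ← add_assoc] at hil
        exact add_right_cancel hil
      rcases Nat.lt_or_ge (n - 1 - i) 2 with hi2 | hi2
      · generalize n - 1 - i = j at *
        interval_cases j <;> simp [hy]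
      · exfalso
        refine hnot 0 1 (by omega) (by omega) (by omega) h0 ?_
        intro hm
        rw [mem_ap, hy] at hm
        obtain ⟨k, hk, hkj⟩ := hm
        rw [add_assoc, ← add_nsmul] at hkj
        have := nsmul_inj_of_lt (by omega) (by omega) (add_left_cancel hkj)
        omega
    · exact (hnot 0 (n - 1) (by omega) (by omega) (by omega) h0 hl).elim

theorem cap_shift {d x y : G} {h : ℕ} (hh : 1 ≤ h) (hd : 2 * (2 * h + 1) ≤ addOrderOf d)
    (hc : #(cap x d h \ cap y d h) ≤ 1) : x = y ∨ x = y + d ∨ x = y - d := by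
  rcases ap_shift (by omega) hd hc with h1 | h1 | h1
  · left; simpa using h1
  · right; left
    have : x = y - h • d + d + h • d := by rw [← h1]; abel
    rw [this]; abel
  · right; right
    have : x = y - h • d - d + h • d := by rw [← h1]; abel
    rw [this]; abel

/-- Translation by d' gains at most one element; read in steps of d, such a translation is a single
step. -/
theorem cap_diff_unique [Fintype G] {Q h : ℕ} {S : Finset G} {c c' d d' : G} (hS : LargeDiff Q S)
    (hQ : 2 * (2 * h + 1) ≤ Q) (hh : 1 ≤ h) (hc : #S = 2 * h + 1) (h1 : S = cap c d h)
    (h2 : S = cap c' d' h) : d' = d ∨ d' = -d := by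
  have o1 := le_addOrderOf_of_isAP (isAP_cap hc h1) hS (by omega)
  have o2 := le_addOrderOf_of_isAP (isAP_cap hc h2) hS (by omega)
  have hd0 : d' ≠ 0 := by
    rintro rfl
    rw [addOrderOf_zero] at o2
    omega
  have e1 : d' +ᵥ S = cap (c + d') d h := by
    rw [h1]
    ext z
    rw [mem_vadd_iff, cap, cap, mem_ap, mem_ap]
    constructor
    · rintro ⟨i, hi, e⟩
      exact ⟨i, hi, by rw [← sub_add_cancel z d', ← e]; abel⟩
    · rintro ⟨i, hi, e⟩
      exact ⟨i, hi, by rw [← e]; abel⟩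
  have e2 : #((d' +ᵥ S) \ S) ≤ 1 := by
    have h3 : #(S ∩ (d' +ᵥ S)) = 2 * h := by
      rw [h2, cap, ap_inter_vadd _ (by omega), card_ap _ (by omega)]
    have h4 : #((d' +ᵥ S) \ S) + #((d' +ᵥ S) ∩ S) = #(d' +ᵥ S) := card_sdiff_add_card_inter _ _
    rw [inter_comm, h3, card_vadd_finset] at h4
    omega
  rw [e1] at e2
  nth_rw 1 [h1] at e2
  rcases cap_shift hh (by omega) e2 with h5 | h5 | h5
  · exact absurd (by simpa using h5) hd0
  · left; simpa using h5
  · right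
    rw [sub_eq_add_neg] at h5
    exact add_left_cancel h5

variable [Fintype G]

/-- Each point of T is charged h + 1, and Pollard's bound at level h + 1 covers the rest. -/
theorem sum_rep_le {Q h : ℕ} {X Y : Finset G} (hY : LargeDiff Q Y)
    (hQ : 3 * (2 * h + 1) ≤ Q) (hXc : #X = 2 * h + 1) (hYc : #Y = 2 * h + 1) (T : Finset G) :
    ∑ x ∈ T, rep X Y x ≤ (h + 1) * #T + h ^ 2 := by
  have h1 := exc_le (A := X) (t := h + 1) hY (by omega) (by omega) (by omega)
  rw [hXc, hYc, show 2 * h + 1 - (h + 1) = h by omega] at h1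
  have h2 : ∑ x ∈ T, (rep X Y x - (h + 1)) ≤ exc X Y (h + 1) :=
    sum_le_univ_sum_of_nonneg fun _ => Nat.zero_le _
  have h3 : ∑ x ∈ T, rep X Y x ≤ ∑ x ∈ T, (rep X Y x - (h + 1)) + #T * (h + 1) := by
    rw [← smul_eq_mul, ← sum_const, ← sum_add_distrib]
    exact sum_le_sum fun _ _ => by omega
  nlinarith

/-- The maximal number of sums in a set of the same size determines a triple of progressions. -/
theorem exists_cap_of_sum_rep_eq {Q h : ℕ} {X Y T : Finset G} (hX : LargeDiff Q X)
    (hY : LargeDiff Q Y) (hT : LargeDiff Q T) (hQ : 3 * (2 * h + 1) ≤ Q) (hh : 1 ≤ h)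
    (hXc : #X = 2 * h + 1) (hYc : #Y = 2 * h + 1) (hTc : #T = 2 * h + 1)
    (hs : ∑ x ∈ T, rep X Y x = 3 * h ^ 2 + 3 * h + 1) :
    ∃ c c' d, X = cap c d h ∧ Y = cap c' d h ∧ T = cap (c + c') d h := by
  -- The prescribed value is also (2h + 1)h + (h + 1)². So level h is tight too: T carries an excess
  -- equal to Pollard's bound, and no sum outside T exceeds h.
  have h1 := exc_le (A := X) (t := h) hY (by omega) (by omega) (by omega)
  rw [hXc, hYc, show 2 * h + 1 - h = h + 1 by omega] at h1
  have h3 : ∑ x ∈ T, rep X Y x ≤ ∑ x ∈ T, (rep X Y x - h) + #T * h := by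
    rw [← smul_eq_mul, ← sum_const, ← sum_add_distrib]
    exact sum_le_sum fun _ _ => by omega
  have h4 : ∑ x ∈ T, (rep X Y x - h) + ∑ x ∈ Tᶜ, (rep X Y x - h) = exc X Y h := by
    rw [exc, sum_add_sum_compl]
  have h5 : (h + 1) * (h + 1) + ∑ x ∈ Tᶜ, (rep X Y x - h) ≤ exc X Y h := by
    rw [hs, hTc] at h3
    nlinarith
  have h6 : ∀ x, h < rep X Y x → x ∈ T := by
    intro x hx
    by_contra hxT
    have h7 : ∑ x ∈ Tᶜ, (rep X Y x - h) = 0 := by omega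
    have := sum_eq_zero_iff.1 h7 x (by simpa using hxT)
    omega
  have hext : Extremal X Y h := by
    rw [Extremal, hXc, hYc, show 2 * h + 1 - h = h + 1 by omega]
    omega
  have hsub : univ.filter (fun x => h < rep X Y x) ⊆ T := fun x hx => h6 x (mem_filter.1 hx).2
  obtain ⟨d, hdX, hdY⟩ := hext.exists_isAP (M := 2 * h + 1) hQ hh hX hY (by omega) (by omega)
    (by omega) (by omega) (fun _ => ⟨hT.mono hsub, (card_le_card hsub).trans (by omega)⟩)
  have hord := le_addOrderOf_of_isAP hdX hX (by omega)
  obtain ⟨c, hc⟩ := hdX.exists_cap hXc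
  obtain ⟨c', hc'⟩ := hdY.exists_cap hYc
  refine ⟨c, c', d, hc, hc', (eq_of_subset_of_card_le ?_ ?_).symm⟩
  · intro z hz
    rw [cap, mem_ap] at hz
    obtain ⟨i, hi, rfl⟩ := hz
    apply h6
    have := rep_ap_ge (c - h • d) (c' - h • d) (d := d) (n := 2 * h + 1) (by omega) (h + i)
    rw [hc, hc', cap, cap]
    have e : c - h • d + (c' - h • d) + (h + i) • d = c + c' - h • d + i • d := by
      rw [add_nsmul]; abel
    rw [e] at this
    omega
  · rw [cap, card_ap _ (by omega), hTc]

/-- The middle progression, centred at c + c', absorbs the entire excess at level h. A point outside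
it has at most h representations, one fewer than the charge in `sum_rep_le`. -/
theorem sum_rep_cap_add_le {Q h : ℕ} {c c' d : G} (hY : LargeDiff Q (cap c' d h))
    (hQ : 3 * (2 * h + 1) ≤ Q) (hd : Q ≤ addOrderOf d) (T : Finset G) :
    ∑ x ∈ T, rep (cap c d h) (cap c' d h) x + #(T \ cap (c + c') d h) ≤ (h + 1) * #T + h ^ 2 := by
  have hX' : #(cap c d h) = 2 * h + 1 := card_ap _ (by omega)
  have hY' : #(cap c' d h) = 2 * h + 1 := card_ap _ (by omega)
  set X := cap c d h with hXdef
  set Y := cap c' d h with hYdef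
  have h1 := exc_le (A := X) (t := h + 1) hY (by omega) (by omega) (by omega)
  rw [hX', hY', show 2 * h + 1 - (h + 1) = h by omega] at h1
  have h2 := exc_le (A := X) (t := h) hY (by omega) (by omega) (by omega)
  rw [hX', hY', show 2 * h + 1 - h = h + 1 by omega] at h2
  have h3 := sq_le_sum_rep_ap (c - h • d) (c' - h • d) (d := d) (n := 2 * h + 1) (t := h) (by omega)
  have e : c - h • d + (c' - h • d) + h • d = c + c' - h • d := by abel
  rw [e, show 2 * (2 * h + 1 - h) - 1 = 2 * h + 1 by omega,
    show 2 * h + 1 - h = h + 1 by omega] at h3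
  change (h + 1) ^ 2 ≤ ∑ z ∈ cap (c + c') d h, (rep X Y z - h) at h3
  have h4 : ∑ x ∈ cap (c + c') d h, (rep X Y x - h) + ∑ x ∈ (cap (c + c') d h)ᶜ, (rep X Y x - h)
      = exc X Y h := by
    rw [exc, sum_add_sum_compl]
  have h5 : ∀ x, x ∉ cap (c + c') d h → rep X Y x ≤ h := by
    intro x hx
    have h7 : ∑ x ∈ (cap (c + c') d h)ᶜ, (rep X Y x - h) = 0 := by
      rw [sq] at h3; omega
    have := sum_eq_zero_iff.1 h7 x (by simpa using hx)
    omega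
  have h6 : ∑ x ∈ T, (rep X Y x - (h + 1)) ≤ exc X Y (h + 1) :=
    sum_le_univ_sum_of_nonneg fun _ => Nat.zero_le _
  have h7 : ∑ x ∈ T, rep X Y x + #(T \ cap (c + c') d h)
      ≤ ∑ x ∈ T, (rep X Y x - (h + 1)) + #T * (h + 1) := by
    rw [← filter_notMem_eq_sdiff, card_filter, ← smul_eq_mul, ← sum_const, ← sum_add_distrib,
      ← sum_add_distrib]
    refine sum_le_sum fun x _ => ?_
    split_ifs with hx
    · omega
    · have := h5 x hx; omega
  nlinarith

end Centred

/-! ### Transversals, their fibres and sections -/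

section Transversals

variable {G N H : Type*} [AddCommGroup G] [DecidableEq G] [Fintype G]
  [AddCommGroup N] [DecidableEq N] [Fintype N] [AddCommGroup H] [DecidableEq H] [Fintype H]

/-- `A` contains exactly one element of each fibre of `ψ`. -/
def IsTransversal (ψ : G →+ N) (A : Finset G) : Prop := ∀ c, ∃! a, a ∈ A ∧ ψ a = c

theorem IsTransversal.injOn {ψ : G →+ N} {A : Finset G} (hA : IsTransversal ψ A) {x y : G}
    (hx : x ∈ A) (hy : y ∈ A) (h : ψ x = ψ y) : x = y :=
  (hA (ψ y)).unique ⟨hx, h⟩ ⟨hy, rfl⟩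

theorem IsTransversal.card_filter_map {ψ : G →+ N} {A : Finset G} (hA : IsTransversal ψ A)
    (P : N → Prop) [DecidablePred P] : #{a ∈ A | P (ψ a)} = #{c | P c} := by
  refine card_bij (fun a _ => ψ a) ?_ ?_ ?_
  · intro a ha
    simpa using (mem_filter.1 ha).2
  · intro a ha b hb h
    exact hA.injOn (mem_filter.1 ha).1 (mem_filter.1 hb).1 h
  · intro c hc
    obtain ⟨a, ⟨ha, hac⟩, -⟩ := hA c
    exact ⟨a, mem_filter.2 ⟨ha, by simpa [hac] using hc⟩, hac⟩

theorem IsTransversal.card_eq {ψ : G →+ N} {A : Finset G} (hA : IsTransversal ψ A) :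
    #A = Fintype.card N := by
  have := hA.card_filter_map fun _ => True
  simpa using this

theorem IsTransversal.largeDiff {Q : ℕ} {ψ : G →+ N} {A : Finset G} (hA : IsTransversal ψ A)
    (hQ : ∀ x, ψ x ≠ 0 → Q ≤ addOrderOf x) : LargeDiff Q A := by
  intro x hx y hy hxy
  refine hQ _ fun h => hxy (hA.injOn hx hy ?_)
  rwa [map_sub, sub_eq_zero] at h

/-- Each element of A has exactly one partner in B whose sum falls in the given class. -/
theorem IsTransversal.sum_rep_fibre {ψ : G →+ N} {A B : Finset G} (hB : IsTransversal ψ B)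
    (c : N) : ∑ x with ψ x = c, rep A B x = #A := by
  simp_rw [rep, card_filter]
  rw [sum_comm, card_eq_sum_ones]
  refine sum_congr rfl fun a _ => ?_
  rw [← card_filter, filter_filter, card_eq_one]
  obtain ⟨b, ⟨hb, hbc⟩, hu⟩ := hB (c - ψ a)
  refine ⟨a + b, ?_⟩
  ext x
  rw [mem_filter, mem_singleton]
  constructor
  · rintro ⟨-, hx, hxa⟩
    have := hu (x - a) ⟨hxa, by rw [map_sub, hx]⟩
    rw [← this]; abel
  · rintro rfl
    refine ⟨mem_univ _, ?_, by simpa using hb⟩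
    rw [map_add, hbc]; abel

/-- A class contains at most one sum with more than half of the representations. -/
theorem IsTransversal.popular_injective {ψ : G →+ N} {A B : Finset G} {t : ℕ}
    (hB : IsTransversal ψ B) (ht : #A < 2 * t) {x y : G} (hx : t ≤ rep A B x)
    (hy : t ≤ rep A B y) (h : ψ x = ψ y) : x = y := by
  by_contra hxy
  have h1 := hB.sum_rep_fibre (A := A) (ψ y)
  have h2 : ∑ z ∈ {x, y}, rep A B z ≤ ∑ z with ψ z = ψ y, rep A B z := by
    refine sum_le_sum_of_subset fun z hz => ?_
    rw [mem_insert, mem_singleton] at hz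
    rcases hz with rfl | rfl <;> simp [h]
  rw [sum_pair hxy] at h2
  omega

/-- The part of `A` lying over `i`. -/
def fib (φ : G →+ H) (A : Finset G) (i : H) : Finset G := A.filter fun a => φ a = i

theorem mem_fib {φ : G →+ H} {A : Finset G} {i : H} {x : G} : x ∈ fib φ A i ↔ x ∈ A ∧ φ x = i :=
  mem_filter

theorem fib_subset (φ : G →+ H) (A : Finset G) (i : H) : fib φ A i ⊆ A := filter_subset _ _

theorem rep_eq_sum_rep_fib (φ : G →+ H) (A B : Finset G) (x : G) :
    rep A B x = ∑ i, rep (fib φ A i) (fib φ B (φ x - i)) x := by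
  rw [rep, card_eq_sum_card_fiberwise (f := φ) (t := univ) fun a _ => by simp]
  refine sum_congr rfl fun i _ => ?_
  rw [rep]
  congr 1
  ext a
  simp only [mem_filter, mem_fib]
  constructor
  · rintro ⟨⟨h1, h2⟩, rfl⟩
    exact ⟨⟨h1, rfl⟩, h2, by rw [map_sub]⟩
  · rintro ⟨⟨h1, h2⟩, h3, -⟩
    exact ⟨⟨h1, h3⟩, h2⟩

theorem sum_rep_eq_sum_fib (φ : G →+ H) (A B S : Finset G) {k : H} (hS : ∀ x ∈ S, φ x = k) :
    ∑ x ∈ S, rep A B x = ∑ i, ∑ x ∈ S, rep (fib φ A i) (fib φ B (k - i)) x := by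
  rw [sum_comm]
  refine sum_congr rfl fun x hx => ?_
  rw [rep_eq_sum_rep_fib φ, hS x hx]

theorem rep_image_section {φ : G →+ H} {a b : H → G} (ha : ∀ i, φ (a i) = i)
    (hb : ∀ i, φ (b i) = i) (x : G) :
    rep (univ.image a) (univ.image b) x = #{i | a i + b (φ x - i) = x} := by
  symm
  refine card_bij (fun i _ => a i) ?_ ?_ ?_
  · intro i hi
    have hi' := (mem_filter.1 hi).2
    refine mem_filter.2 ⟨mem_image_of_mem a (mem_univ i), mem_image.2 ⟨φ x - i, mem_univ _, ?_⟩⟩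
    nth_rw 2 [← hi']; abel
  · intro i _ j _ h
    rw [← ha i, ← ha j, h]
  · intro y hy
    obtain ⟨h1, h2⟩ := mem_filter.1 hy
    obtain ⟨i, -, rfl⟩ := mem_image.1 h1
    obtain ⟨j, -, hj⟩ := mem_image.1 h2
    refine ⟨i, mem_filter.2 ⟨mem_univ i, ?_⟩, rfl⟩
    have : j = φ x - i := by rw [← hb j, hj, map_sub, ha]
    rw [← this, hj]; abel

theorem isTransversal_image_section {φ : G →+ H} {a : H → G} (ha : ∀ i, φ (a i) = i) :
    IsTransversal φ (univ.image a) := by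
  intro c
  refine ⟨a c, ⟨mem_image_of_mem a (mem_univ c), ha c⟩, ?_⟩
  rintro y ⟨hy, hyc⟩
  obtain ⟨i, -, rfl⟩ := mem_image.1 hy
  rw [← hyc, ha]

/-- Here s is the number of popular sums over one class and f i the share of one pair of fibres. For
s ≤ 2h the slack is l(2h - s). For s = 2h + 1 the main term exceeds the total of non-maximal shares
by l + 1, so only maximal shares beyond the first l + 1 matter. -/
theorem sum_le_of_fibre_bounds {h l s : ℕ} (f : H → ℕ) (hH : Fintype.card H = 2 * l + 1)
    (hs : s ≤ 2 * h + 1) (hf : ∀ i, f i ≤ (h + 1) * s + h ^ 2) :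
    ∑ i, f i ≤ ((2 * l + 1) * h + l + 1) * s + ((2 * l + 1) * h ^ 2 + 2 * h * l)
      + ((if s = 2 * h + 1 then #{i | f i = 3 * h ^ 2 + 3 * h + 1} else 0) - (l + 1)) ∧
    (1 ≤ l → ∑ i, f i = ((2 * l + 1) * h + l + 1) * s + ((2 * l + 1) * h ^ 2 + 2 * h * l)
      + ((if s = 2 * h + 1 then #{i | f i = 3 * h ^ 2 + 3 * h + 1} else 0) - (l + 1)) →
      (s = 2 * h + 1 ∧ l + 1 ≤ #{i | f i = 3 * h ^ 2 + 3 * h + 1} ∧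
        ∀ i, 3 * h ^ 2 + 3 * h ≤ f i) ∨
      (s = 2 * h ∧ ∀ i, f i = (h + 1) * s + h ^ 2)) := by
  rcases hs.eq_or_lt with rfl | hlt
  · rw [if_pos rfl]
    have e : (h + 1) * (2 * h + 1) + h ^ 2 = 3 * h ^ 2 + 3 * h + 1 := by ring
    rw [e] at hf
    set Z := #{i | f i = 3 * h ^ 2 + 3 * h + 1} with hZ
    have hle : ∀ i ∈ univ, f i ≤ (3 * h ^ 2 + 3 * h)
        + if f i = 3 * h ^ 2 + 3 * h + 1 then 1 else 0 := by
      intro i _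
      have := hf i
      split_ifs <;> omega
    have hsum : ∑ i, ((3 * h ^ 2 + 3 * h) + if f i = 3 * h ^ 2 + 3 * h + 1 then 1 else 0)
        = (2 * l + 1) * (3 * h ^ 2 + 3 * h) + Z := by
      rw [sum_add_distrib, sum_const, card_univ, hH, smul_eq_mul, hZ, card_filter]
    have h1 := sum_le_sum hle
    rw [hsum] at h1
    have e2 : (2 * l + 1) * (3 * h ^ 2 + 3 * h) + (l + 1)
        = ((2 * l + 1) * h + l + 1) * (2 * h + 1) + ((2 * l + 1) * h ^ 2 + 2 * h * l) := by ring
    refine ⟨by omega, fun _ heq => Or.inl ⟨rfl, by omega, fun i => ?_⟩⟩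
    have h2 := (sum_eq_sum_iff_of_le hle).1 (by rw [hsum]; omega) i (mem_univ i)
    rw [h2]; omega
  · rw [if_neg (by omega)]
    have h1 : ∑ i, f i ≤ ∑ _i : H, ((h + 1) * s + h ^ 2) := sum_le_sum fun i _ => hf i
    have hsum : ∑ _i : H, ((h + 1) * s + h ^ 2) = (2 * l + 1) * ((h + 1) * s + h ^ 2) := by
      rw [sum_const, card_univ, hH, smul_eq_mul]
    have e2 : (2 * l + 1) * ((h + 1) * s + h ^ 2)
        = ((2 * l + 1) * h + l + 1) * s + ((2 * l + 1) * h ^ 2 + s * l) := by ring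
    have h3 : s * l ≤ 2 * h * l := Nat.mul_le_mul_right l (by omega)
    refine ⟨by omega, fun hl heq => Or.inr ?_⟩
    have h4 : s * l = 2 * h * l := by omega
    have h5 : s = 2 * h := Nat.eq_of_mul_eq_mul_right hl h4
    refine ⟨h5, fun i => ?_⟩
    exact (sum_eq_sum_iff_of_le (fun i _ => hf i)).1 (by omega) i (mem_univ i)

/-- The centres of the fibres of a transversal, with arbitrary representatives for those fibres
which are not progressions. -/
theorem exists_centres {Q h : ℕ} {φ : G →+ H} {A : Finset G} (hA : LargeDiff Q A)
    (hQ : 2 * h + 1 < Q) (hh : 1 ≤ h) (hc : ∀ i, #(fib φ A i) = 2 * h + 1) :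
    ∃ a : H → G, ∀ i, a i ∈ fib φ A i ∧ ∀ c d, fib φ A i = cap c d h → a i = c := by
  have : ∀ i, ∃ x, x ∈ fib φ A i ∧ ∀ c d, fib φ A i = cap c d h → x = c := by
    intro i
    by_cases hex : ∃ c d, fib φ A i = cap c d h
    · obtain ⟨c, d, hcd⟩ := hex
      exact ⟨c, hcd ▸ mem_cap_self c d h, fun c' d' h' =>
        cap_center_unique (hA.mono (fib_subset φ A i)) hQ hh (hc i) hcd h'⟩
    · obtain ⟨x, hx⟩ := card_pos.1 (show 0 < #(fib φ A i) by rw [hc]; omega)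
      exact ⟨x, hx, fun c d h' => absurd ⟨c, d, h'⟩ hex⟩
  choose a ha using this
  exact ⟨a, ha⟩

end Transversals

/-! ### Comparison of the excess with that of the sets of centres -/

section FibreStep

variable {G N H : Type*} [AddCommGroup G] [DecidableEq G] [Fintype G]
  [AddCommGroup N] [DecidableEq N] [Fintype N] [AddCommGroup H] [DecidableEq H] [Fintype H]

/-- Values which pairwise differ by at most one step take one value more than half of the time. -/
theorem exists_majority {l : ℕ} {d : G} (hd : 4 ≤ addOrderOf d) (hH : Fintype.card H = 2 * l + 1)
    (e : H → G) (he : ∀ i j, e i = e j ∨ e i = e j + d ∨ e i = e j - d) :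
    ∃ j, l + 1 ≤ #{i | e i = e j} := by
  have h1 : (1 : ℕ) • d ≠ 0 := fun h => by
    have := addOrderOf_le_of_nsmul_eq_zero one_pos h; omega
  have h2 : (2 : ℕ) • d ≠ 0 := fun h => by
    have := addOrderOf_le_of_nsmul_eq_zero two_pos h; omega
  have h3 : (3 : ℕ) • d ≠ 0 := fun h => by
    have := addOrderOf_le_of_nsmul_eq_zero three_pos h; omega
  by_cases hall : ∀ i, e i = e 0
  · refine ⟨0, ?_⟩
    rw [filter_true_of_mem fun i _ => hall i, card_univ, hH]
    omega
  · push Not at hall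
    obtain ⟨j, hj⟩ := hall
    -- A third value would make d, 2d or 3d vanish.
    have htwo : ∀ i, e i = e 0 ∨ e i = e j := by
      intro i
      rcases he i 0 with h | h | h
      · exact Or.inl h
      · rcases he j 0 with h' | h' | h'
        · exact absurd h' hj
        · exact Or.inr (h.trans h'.symm)
        · exfalso
          rcases he i j with h'' | h'' | h'' <;> rw [h, h'] at h''
          · apply h2
            have : (e 0 + d) - (e 0 - d) = 0 := by rw [h'']; abel
            rw [← this]; abel
          · apply h1
            have : (e 0 + d) - (e 0 - d + d) = 0 := by rw [← h'']; abel
            rw [← this]; abel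
          · apply h3
            have : (e 0 + d) - (e 0 - d - d) = 0 := by rw [← h'']; abel
            rw [← this]; abel
      · rcases he j 0 with h' | h' | h'
        · exact absurd h' hj
        · exfalso
          rcases he j i with h'' | h'' | h'' <;> rw [h, h'] at h''
          · apply h2
            have : (e 0 + d) - (e 0 - d) = 0 := by rw [h'']; abel
            rw [← this]; abel
          · apply h1
            have : (e 0 + d) - (e 0 - d + d) = 0 := by rw [← h'']; abel
            rw [← this]; abel
          · apply h3
            have : (e 0 + d) - (e 0 - d - d) = 0 := by rw [← h'']; abel
            rw [← this]; abel
        · exact Or.inr (h.trans h'.symm)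
    have hc : 2 * l + 1 ≤ #{i | e i = e 0} + #{i | e i = e j} := by
      rw [← hH, ← card_univ]
      refine le_trans (card_le_card fun i _ => ?_) (card_union_le _ _)
      rw [mem_union, mem_filter, mem_filter]
      rcases htwo i with h | h
      · exact Or.inl ⟨mem_univ i, h⟩
      · exact Or.inr ⟨mem_univ i, h⟩
    by_cases hm : l + 1 ≤ #{i | e i = e 0}
    · exact ⟨0, hm⟩
    · exact ⟨j, by omega⟩

/-- The sums lying over `k` with more than `t` representations. -/
def popFib (φ : G →+ H) (A B : Finset G) (t : ℕ) (k : H) : Finset G :=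
  univ.filter fun x => t < rep A B x ∧ φ x = k

theorem exc_eq_sum_popFib (φ : G →+ H) (A B : Finset G) (t : ℕ) :
    exc A B t = ∑ k, ∑ x ∈ popFib φ A B t k, (rep A B x - t) := by
  rw [exc, ← sum_fiberwise univ φ]
  refine sum_congr rfl fun k _ => (sum_subset ?_ ?_).symm
  · intro x hx
    rw [popFib, mem_filter] at hx
    simpa using hx.2.2
  · intro x hx hx'
    rw [popFib, mem_filter] at hx'
    have h1 : φ x = k := by simpa using hx
    by_contra hc
    exact hx' ⟨mem_univ x, by omega, h1⟩

theorem sum_popFib (φ : G →+ H) (A B : Finset G) (t : ℕ) (k : H) :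
    ∑ x ∈ popFib φ A B t k, rep A B x
      = ∑ x ∈ popFib φ A B t k, (rep A B x - t) + t * #(popFib φ A B t k) := by
  rw [mul_comm, ← smul_eq_mul, ← sum_const, ← sum_add_distrib]
  refine sum_congr rfl fun x hx => ?_
  rw [popFib, mem_filter] at hx
  omega

/-- The situation of two transversals over `N`, fibred over a quotient `H` of `N`. -/
structure Tower (ψ : G →+ N) (θ : N →+ H) (h l Q : ℕ) (A B : Finset G) : Prop where
  hord : ∀ x, ψ x ≠ 0 → Q ≤ addOrderOf x
  hQ : 3 * (2 * h + 1) ≤ Q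
  hh : 1 ≤ h
  hH : Fintype.card H = 2 * l + 1
  hfib : ∀ i, #{c | θ c = i} = 2 * h + 1
  hA : IsTransversal ψ A
  hB : IsTransversal ψ B

namespace Tower

variable {ψ : G →+ N} {θ : N →+ H} {h l Q : ℕ} {A B : Finset G}

theorem card_fib_left (S : Tower ψ θ h l Q A B) (i : H) : #(fib (θ.comp ψ) A i) = 2 * h + 1 := by
  rw [← S.hfib i, ← S.hA.card_filter_map]; rfl

theorem card_fib_right (S : Tower ψ θ h l Q A B) (i : H) : #(fib (θ.comp ψ) B i) = 2 * h + 1 := by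
  rw [← S.hfib i, ← S.hB.card_filter_map]; rfl

theorem card_left (S : Tower ψ θ h l Q A B) : #A = (2 * l + 1) * (2 * h + 1) := by
  rw [card_eq_sum_card_fiberwise (f := θ.comp ψ) (t := univ) fun a _ => by simp]
  refine (sum_congr rfl fun i _ => S.card_fib_left i).trans ?_
  rw [sum_const, card_univ, S.hH, smul_eq_mul]

theorem popular_inj (S : Tower ψ θ h l Q A B) {x y : G}
    (hx : (2 * l + 1) * h + l + 1 ≤ rep A B x) (hy : (2 * l + 1) * h + l + 1 ≤ rep A B y)
    (hxy : ψ x = ψ y) : x = y := by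
  refine S.hB.popular_injective (t := (2 * l + 1) * h + l + 1) ?_ hx hy hxy
  rw [S.card_left]
  have : (2 * l + 1) * (2 * h + 1) + 1 = 2 * ((2 * l + 1) * h + l + 1) := by ring
  omega

theorem largeDiff_popFib (S : Tower ψ θ h l Q A B) (k : H) :
    LargeDiff Q (popFib (θ.comp ψ) A B ((2 * l + 1) * h + l + 1) k) := by
  intro x hx y hy hxy
  rw [popFib, mem_filter] at hx hy
  refine S.hord _ fun h0 => hxy (S.popular_inj hx.2.1.le hy.2.1.le ?_)
  rwa [map_sub, sub_eq_zero] at h0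

theorem card_popFib_le (S : Tower ψ θ h l Q A B) (k : H) :
    #(popFib (θ.comp ψ) A B ((2 * l + 1) * h + l + 1) k) ≤ 2 * h + 1 := by
  rw [← S.hfib k]
  refine card_le_card_of_injOn ψ ?_ ?_
  · intro x hx
    rw [mem_coe, popFib, mem_filter] at hx
    rw [mem_coe, mem_filter]
    exact ⟨mem_univ _, hx.2.2⟩
  · intro x hx y hy hxy
    rw [mem_coe, popFib, mem_filter] at hx hy
    exact S.popular_inj hx.2.1.le hy.2.1.le hxy

/-- The number of sums from the fibres over `i` and `k - i` which are popular sums. -/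
def cnt (ψ : G →+ N) (θ : N →+ H) (h l : ℕ) (A B : Finset G) (k i : H) : ℕ :=
  ∑ x ∈ popFib (θ.comp ψ) A B ((2 * l + 1) * h + l + 1) k,
    rep (fib (θ.comp ψ) A i) (fib (θ.comp ψ) B (k - i)) x

/-- The number of indices for which `cnt` is as large as possible. -/
def full (ψ : G →+ N) (θ : N →+ H) (h l : ℕ) (A B : Finset G) (k : H) : ℕ :=
  if #(popFib (θ.comp ψ) A B ((2 * l + 1) * h + l + 1) k) = 2 * h + 1 then
    #{i | cnt ψ θ h l A B k i = 3 * h ^ 2 + 3 * h + 1} else 0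

theorem largeDiff_left (S : Tower ψ θ h l Q A B) : LargeDiff Q A := S.hA.largeDiff S.hord

theorem largeDiff_right (S : Tower ψ θ h l Q A B) : LargeDiff Q B := S.hB.largeDiff S.hord

theorem excess_le (S : Tower ψ θ h l Q A B) (k : H) :
    ∑ x ∈ popFib (θ.comp ψ) A B ((2 * l + 1) * h + l + 1) k,
      (rep A B x - ((2 * l + 1) * h + l + 1))
      ≤ (2 * l + 1) * h ^ 2 + 2 * h * l + (full ψ θ h l A B k - (l + 1)) ∧
    (1 ≤ l → ∑ x ∈ popFib (θ.comp ψ) A B ((2 * l + 1) * h + l + 1) k,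
      (rep A B x - ((2 * l + 1) * h + l + 1))
      = (2 * l + 1) * h ^ 2 + 2 * h * l + (full ψ θ h l A B k - (l + 1)) →
      (#(popFib (θ.comp ψ) A B ((2 * l + 1) * h + l + 1) k) = 2 * h + 1 ∧
        l + 1 ≤ #{i | cnt ψ θ h l A B k i = 3 * h ^ 2 + 3 * h + 1} ∧
        ∀ i, 3 * h ^ 2 + 3 * h ≤ cnt ψ θ h l A B k i) ∨
      (#(popFib (θ.comp ψ) A B ((2 * l + 1) * h + l + 1) k) = 2 * h ∧
        ∀ i, cnt ψ θ h l A B k i = (h + 1) * (2 * h) + h ^ 2)) := by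
  have h1 := sum_le_of_fibre_bounds (h := h) (l := l) (cnt ψ θ h l A B k) S.hH (S.card_popFib_le k)
    (fun i => sum_rep_le (S.largeDiff_right.mono (fib_subset _ B (k - i))) S.hQ (S.card_fib_left i)
      (S.card_fib_right (k - i)) _)
  have h2 : ∑ i, cnt ψ θ h l A B k i
      = ∑ x ∈ popFib (θ.comp ψ) A B ((2 * l + 1) * h + l + 1) k, rep A B x :=
    (sum_rep_eq_sum_fib (θ.comp ψ) A B _ fun x hx => (mem_filter.1 hx).2.2).symm
  rw [h2, sum_popFib] at h1
  change _ ≤ _ + _ + (full ψ θ h l A B k - (l + 1)) ∧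
    (_ → _ = _ + _ + (full ψ θ h l A B k - (l + 1)) → _) at h1
  refine ⟨by omega, fun hl heq => ?_⟩
  rcases h1.2 hl (by omega) with h3 | ⟨h3, h4⟩
  · exact Or.inl h3
  · refine Or.inr ⟨h3, fun i => ?_⟩
    rw [h4 i, h3]

/-- Sections through the centres of the fibres of both sets. -/
structure Centres (S : Tower ψ θ h l Q A B) (a b : H → G) : Prop where
  ha : ∀ i, a i ∈ fib (θ.comp ψ) A i ∧ ∀ c d, fib (θ.comp ψ) A i = cap c d h → a i = c
  hb : ∀ i, b i ∈ fib (θ.comp ψ) B i ∧ ∀ c d, fib (θ.comp ψ) B i = cap c d h → b i = c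

theorem exists_centres (S : Tower ψ θ h l Q A B) : ∃ a b, Centres S a b := by
  have hQ := S.hQ
  obtain ⟨a, ha⟩ := DigitalPollard.exists_centres S.largeDiff_left (by omega) S.hh S.card_fib_left
  obtain ⟨b, hb⟩ := DigitalPollard.exists_centres S.largeDiff_right (by omega) S.hh
    S.card_fib_right
  exact ⟨a, b, ha, hb⟩

namespace Centres

variable {S : Tower ψ θ h l Q A B} {a b : H → G}

theorem map_left (C : Centres S a b) (i : H) : θ.comp ψ (a i) = i := (mem_fib.1 (C.ha i).1).2

theorem map_right (C : Centres S a b) (i : H) : θ.comp ψ (b i) = i := (mem_fib.1 (C.hb i).1).2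

theorem rep_eq (C : Centres S a b) (x : G) : rep (univ.image a) (univ.image b) x
    = #{i | a i + b (θ.comp ψ x - i) = x} := rep_image_section C.map_left C.map_right x

/-- Indices with full count: the fibres are progressions with a common difference. -/
theorem exists_diff (C : Centres S a b) {k i : H}
    (hk : #(popFib (θ.comp ψ) A B ((2 * l + 1) * h + l + 1) k) = 2 * h + 1)
    (hi : cnt ψ θ h l A B k i = 3 * h ^ 2 + 3 * h + 1) :
    ∃ d, fib (θ.comp ψ) A i = cap (a i) d h ∧ fib (θ.comp ψ) B (k - i) = cap (b (k - i)) d h ∧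
      popFib (θ.comp ψ) A B ((2 * l + 1) * h + l + 1) k = cap (a i + b (k - i)) d h := by
  obtain ⟨c, c', d, h1, h2, h3⟩ := exists_cap_of_sum_rep_eq
    (S.largeDiff_left.mono (fib_subset _ A i)) (S.largeDiff_right.mono (fib_subset _ B (k - i)))
    (S.largeDiff_popFib k) S.hQ S.hh (S.card_fib_left i) (S.card_fib_right (k - i)) hk hi
  have e1 := (C.ha i).2 c d h1
  have e2 := (C.hb (k - i)).2 c' d h2
  exact ⟨d, by rw [e1, h1], by rw [e2, h2], by rw [e1, e2, h3]⟩

/-- All maximal pairs over k yield the same popular progression, so their centres add up to its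
unique centre; each maximal index is a representation of that point. -/
theorem exists_full_le (C : Centres S a b) (k : H) :
    ∃ c, θ.comp ψ c = k ∧ full ψ θ h l A B k ≤ rep (univ.image a) (univ.image b) c := by
  have hQ := S.hQ
  by_cases h0 : full ψ θ h l A B k = 0
  · exact ⟨a k, C.map_left k, by rw [h0]; exact Nat.zero_le _⟩
  have hk : #(popFib (θ.comp ψ) A B ((2 * l + 1) * h + l + 1) k) = 2 * h + 1 := by
    by_contra hne
    exact h0 (by rw [full, if_neg hne])
  rw [full, if_pos hk] at h0 ⊢
  obtain ⟨i₀, hi₀⟩ := card_pos.1 (Nat.pos_of_ne_zero h0)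
  obtain ⟨d, -, -, hd⟩ := C.exists_diff hk (mem_filter.1 hi₀).2
  have hc : θ.comp ψ (a i₀ + b (k - i₀)) = k := by
    rw [map_add, C.map_left, C.map_right]; abel
  refine ⟨a i₀ + b (k - i₀), hc, ?_⟩
  rw [C.rep_eq, hc]
  refine card_le_card fun i hi => ?_
  obtain ⟨d', -, -, hd'⟩ := C.exists_diff hk (mem_filter.1 hi).2
  rw [mem_filter]
  exact ⟨mem_univ i, cap_center_unique (S.largeDiff_popFib k) (by omega) S.hh hk hd' hd⟩

/-- The chosen points lie over different k, so their excesses are separate parts of the excess of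
the sections. -/
theorem sum_full_le (c : H → G) (hc : ∀ k, θ.comp ψ (c k) = k)
    (hle : ∀ k, full ψ θ h l A B k ≤ rep (univ.image a) (univ.image b) (c k)) :
    ∑ k, (full ψ θ h l A B k - (l + 1)) ≤ exc (univ.image a) (univ.image b) (l + 1) ∧
    (∑ k, (full ψ θ h l A B k - (l + 1)) = exc (univ.image a) (univ.image b) (l + 1) →
      ∀ x, l + 1 < rep (univ.image a) (univ.image b) x →
        full ψ θ h l A B (θ.comp ψ x) = rep (univ.image a) (univ.image b) x) := by
  have hinj : ∀ k k', c k = c k' → k = k' := fun k k' hkk => by rw [← hc k, ← hc k', hkk]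
  have h1 : ∀ k ∈ univ, full ψ θ h l A B k - (l + 1)
      ≤ rep (univ.image a) (univ.image b) (c k) - (l + 1) := fun k _ => by
    have := hle k; omega
  have h2 : ∑ k, (rep (univ.image a) (univ.image b) (c k) - (l + 1))
      = ∑ x ∈ univ.image c, (rep (univ.image a) (univ.image b) x - (l + 1)) := by
    rw [sum_image fun k _ k' _ hkk => hinj k k' hkk]
  have h3 : ∑ x ∈ univ.image c, (rep (univ.image a) (univ.image b) x - (l + 1))
      + ∑ x ∈ (univ.image c)ᶜ, (rep (univ.image a) (univ.image b) x - (l + 1))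
      = exc (univ.image a) (univ.image b) (l + 1) := by
    rw [exc, sum_add_sum_compl]
  have h4 := sum_le_sum h1
  refine ⟨by omega, fun heq x hx => ?_⟩
  have h5 : ∑ x ∈ (univ.image c)ᶜ, (rep (univ.image a) (univ.image b) x - (l + 1)) = 0 := by omega
  have h6 : x ∈ univ.image c := by
    by_contra hxc
    have := sum_eq_zero_iff.1 h5 x (by simpa using hxc)
    omega
  obtain ⟨k, -, rfl⟩ := mem_image.1 h6
  have h7 := (sum_eq_sum_iff_of_le h1).1 (by omega) k (mem_univ k)
  rw [hc]
  have := hle k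
  omega

theorem exc_le (C : Centres S a b) :
    exc A B ((2 * l + 1) * h + l + 1) ≤ (2 * l + 1) * ((2 * l + 1) * h ^ 2 + 2 * h * l)
      + exc (univ.image a) (univ.image b) (l + 1) := by
  choose c hc hle using C.exists_full_le
  have h1 := (sum_full_le c hc hle).1
  rw [exc_eq_sum_popFib (θ.comp ψ)]
  have h2 := sum_le_sum fun k (_ : k ∈ (univ : Finset H)) => (S.excess_le k).1
  rw [sum_add_distrib, sum_const, card_univ, S.hH, smul_eq_mul] at h2
  omega

/-- What the fibres look like when the bound is attained. -/
theorem of_exc_eq (C : Centres S a b) (hl : 1 ≤ l)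
    (heq : exc A B ((2 * l + 1) * h + l + 1) = (2 * l + 1) * ((2 * l + 1) * h ^ 2 + 2 * h * l)
      + exc (univ.image a) (univ.image b) (l + 1))
    {x₀ : G} (hx₀ : rep (univ.image a) (univ.image b) x₀ = 2 * l + 1) :
    ∃ d, (∀ i, fib (θ.comp ψ) A i = cap (a i) d h) ∧ (∀ i, fib (θ.comp ψ) B i = cap (b i) d h) ∧
      ∀ k, ∃ c, θ.comp ψ c = k ∧ l + 1 ≤ rep (univ.image a) (univ.image b) c ∧
        ∀ x, θ.comp ψ x = k → 0 < rep (univ.image a) (univ.image b) x →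
          x = c ∨ x = c + d ∨ x = c - d := by
  have hQ := S.hQ
  have hh := S.hh
  choose c hc hle using C.exists_full_le
  obtain ⟨h1, h1'⟩ := sum_full_le c hc hle
  rw [exc_eq_sum_popFib (θ.comp ψ)] at heq
  have hle2 := fun k (_ : k ∈ (univ : Finset H)) => (S.excess_le k).1
  have h2 := sum_le_sum hle2
  have h2' := h2
  rw [sum_add_distrib, sum_const, card_univ, S.hH, smul_eq_mul] at h2
  have halt := fun k => (S.excess_le k).2 hl ((sum_eq_sum_iff_of_le hle2).1 (by
    rw [sum_add_distrib, sum_const, card_univ, S.hH, smul_eq_mul]; omega) k (mem_univ k))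
  -- Equality leaves no waste: all 2l + 1 representations of x₀ by centres come from maximal pairs
  -- of fibres over k₀.
  have hfull := h1' (by omega) x₀ (by omega)
  rw [hx₀] at hfull
  set k₀ := θ.comp ψ x₀ with hk₀
  have hT₀ : #(popFib (θ.comp ψ) A B ((2 * l + 1) * h + l + 1) k₀) = 2 * h + 1 := by
    by_contra hne
    rw [full, if_neg hne] at hfull
    omega
  have hall : ∀ i, cnt ψ θ h l A B k₀ i = 3 * h ^ 2 + 3 * h + 1 := by
    rw [full, if_pos hT₀, ← S.hH, ← card_univ] at hfull
    intro i
    have hi : i ∈ (univ : Finset H) := mem_univ i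
    rw [← eq_of_subset_of_card_le (filter_subset _ _) hfull.ge, mem_filter] at hi
    exact hi.2
  obtain ⟨d, -, -, hd⟩ := C.exists_diff hT₀ (hall 0)
  have hLD := S.largeDiff_popFib k₀
  have hord : Q ≤ addOrderOf d := le_addOrderOf_of_isAP (isAP_cap hT₀ hd) hLD (by omega)
  -- All pairs over k₀ share one popular progression, which fixes their difference up to sign.
  have hboth : ∀ i, fib (θ.comp ψ) A i = cap (a i) d h ∧
      fib (θ.comp ψ) B (k₀ - i) = cap (b (k₀ - i)) d h := by
    intro i
    obtain ⟨d', h3, h4, h5⟩ := C.exists_diff hT₀ (hall i)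
    rcases cap_diff_unique hLD (by omega) hh hT₀ hd h5 with rfl | rfl
    · exact ⟨h3, h4⟩
    · rw [cap_neg_diff] at h3 h4
      exact ⟨h3, h4⟩
  have hfA : ∀ i, fib (θ.comp ψ) A i = cap (a i) d h := fun i => (hboth i).1
  have hfB : ∀ i, fib (θ.comp ψ) B i = cap (b i) d h := fun i => by
    have := (hboth (k₀ - i)).2
    rwa [sub_sub_cancel] at this
  refine ⟨d, hfA, hfB, fun k => ?_⟩
  have hcard : ∀ z : G, #(cap z d h) = 2 * h + 1 := fun z => card_ap _ (by omega)
  have hbound : ∀ i, cnt ψ θ h l A B k i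
      + #(popFib (θ.comp ψ) A B ((2 * l + 1) * h + l + 1) k \ cap (a i + b (k - i)) d h)
      ≤ (h + 1) * #(popFib (θ.comp ψ) A B ((2 * l + 1) * h + l + 1) k) + h ^ 2 := by
    intro i
    rw [cnt, hfA i, hfB (k - i)]
    refine sum_rep_cap_add_le ?_ S.hQ hord _
    rw [← hfB]
    exact S.largeDiff_right.mono (fib_subset _ _ _)
  have hmap : ∀ i, θ.comp ψ (a i + b (k - i)) = k := fun i => by
    rw [map_add, C.map_left, C.map_right]; abel
  have hrep : ∀ x, θ.comp ψ x = k → 0 < rep (univ.image a) (univ.image b) x →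
      ∃ i, a i + b (k - i) = x := by
    intro x hx hpos
    rw [C.rep_eq, hx] at hpos
    obtain ⟨i, hi⟩ := card_pos.1 hpos
    exact ⟨i, (mem_filter.1 hi).2⟩
  -- Either more than half of the pairs are maximal and the others miss by at most one, so their
  -- middle progressions lose at most one point of the popular set. Or the popular set has 2h points
  -- and lies in every middle progression. Both keep the sums of centres within one step d.
  rcases halt k with ⟨hc1, hc2, hc3⟩ | ⟨hc1, hc2⟩
  · have e : (h + 1) * (2 * h + 1) + h ^ 2 = 3 * h ^ 2 + 3 * h + 1 := by ring
    rw [hc1, e] at hbound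
    have hTeq : ∀ i, cnt ψ θ h l A B k i = 3 * h ^ 2 + 3 * h + 1 →
        popFib (θ.comp ψ) A B ((2 * l + 1) * h + l + 1) k = cap (a i + b (k - i)) d h := by
      intro i hi
      have h3 := hbound i
      rw [hi] at h3
      have h4 : popFib (θ.comp ψ) A B ((2 * l + 1) * h + l + 1) k \ cap (a i + b (k - i)) d h
        = ∅ := card_eq_zero.1 (by omega)
      exact eq_of_subset_of_card_le (sdiff_eq_empty_iff_subset.1 h4) (by rw [hcard, hc1])
    obtain ⟨i₀, hi₀⟩ := card_pos.1 (show 0 < _ from (Nat.succ_pos l).trans_le hc2)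
    have hT := hTeq i₀ (mem_filter.1 hi₀).2
    refine ⟨a i₀ + b (k - i₀), hmap i₀, hc2.trans ?_, ?_⟩
    · rw [C.rep_eq, hmap]
      refine card_le_card fun i hi => mem_filter.2 ⟨mem_univ i, ?_⟩
      exact cap_center_unique (S.largeDiff_popFib k) (by omega) hh hc1
        (hTeq i (mem_filter.1 hi).2) hT
    · intro x hx hpos
      obtain ⟨i, rfl⟩ := hrep x hx hpos
      have h3 := hbound i
      have h4 := hc3 i
      rw [hT] at h3
      have h6 : #(cap (a i₀ + b (k - i₀)) d h \ cap (a i + b (k - i)) d h) ≤ 1 := by omega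
      rcases cap_shift hh (by omega) h6 with h5 | h5 | h5
      · exact Or.inl h5.symm
      · right; right; rw [h5]; abel
      · right; left; rw [h5]; abel
  · have hsub : ∀ i, popFib (θ.comp ψ) A B ((2 * l + 1) * h + l + 1) k
        ⊆ cap (a i + b (k - i)) d h := by
      intro i
      have h3 := hbound i
      rw [hc2 i, hc1] at h3
      exact sdiff_eq_empty_iff_subset.1 (card_eq_zero.1 (by omega))
    have hpair : ∀ i j, a i + b (k - i) = a j + b (k - j) ∨
        a i + b (k - i) = a j + b (k - j) + d ∨ a i + b (k - i) = a j + b (k - j) - d := by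
      intro i j
      refine cap_shift hh (by omega) ?_
      refine (card_le_card (sdiff_subset_sdiff subset_rfl (hsub j))).trans ?_
      have := card_sdiff_add_card_eq_card (hsub i)
      rw [hcard, hc1] at this
      omega
    obtain ⟨j, hj⟩ := exists_majority (d := d) (by omega) S.hH _ hpair
    refine ⟨a j + b (k - j), hmap j, ?_, ?_⟩
    · rw [C.rep_eq, hmap]
      exact hj
    · intro x hx hpos
      obtain ⟨i, rfl⟩ := hrep x hx hpos
      exact hpair i j

end Centres

end Tower

end FibreStep

/-! ### Equality for one layer, and gluing of fibres -/

section Abstract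

variable {G N H : Type*} [AddCommGroup G] [DecidableEq G] [Fintype G]
  [AddCommGroup N] [DecidableEq N] [Fintype N] [AddCommGroup H] [DecidableEq H] [Fintype H]

theorem IsTransversal.card_popular_le {ψ : G →+ N} {A B : Finset G} {t : ℕ}
    (hB : IsTransversal ψ B) (ht : #A < 2 * t) : #{x | t ≤ rep A B x} ≤ Fintype.card N := by
  rw [← card_univ]
  refine card_le_card_of_injOn ψ (fun _ _ => mem_coe.2 (mem_univ _)) ?_
  intro x hx y hy hxy
  rw [mem_coe, mem_filter] at hx hy
  exact hB.popular_injective ht hx.2 hy.2 hxy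

theorem IsTransversal.largeDiff_popular {Q : ℕ} {ψ : G →+ N} {A B : Finset G} {t : ℕ}
    (hB : IsTransversal ψ B) (ht : #A < 2 * t) (hQ : ∀ x, ψ x ≠ 0 → Q ≤ addOrderOf x) :
    LargeDiff Q {x | t ≤ rep A B x} := by
  intro x hx y hy hxy
  rw [mem_filter] at hx hy
  refine hQ _ fun h => hxy (hB.popular_injective ht hx.2 hy.2 ?_)
  rwa [map_sub, sub_eq_zero] at h

variable {ψ : G →+ N} {h Q : ℕ} {A B : Finset G}

/-- The equality case at the level `(p - 1) / 2`. -/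
theorem exists_isAP_of_exc_eq_low (hord : ∀ x, ψ x ≠ 0 → Q ≤ addOrderOf x)
    (hQ : 3 * (2 * h + 1) ≤ Q) (hh : 1 ≤ h) (hN : Fintype.card N = 2 * h + 1)
    (hA : IsTransversal ψ A) (hB : IsTransversal ψ B) (heq : exc A B h = (h + 1) ^ 2) :
    ∃ d, IsAP A d ∧ IsAP B d := by
  have hAc := hA.card_eq
  have hBc := hB.card_eq
  refine Extremal.exists_isAP (M := 2 * h + 1) hQ hh (hA.largeDiff hord) (hB.largeDiff hord)
    (by omega) (by omega) (by omega) (by omega) (fun _ => ?_) ?_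
  · exact ⟨hB.largeDiff_popular (t := h + 1) (by omega) hord,
      (hB.card_popular_le (t := h + 1) (by omega)).trans hN.le⟩
  · rw [Extremal, heq, hAc, hBc, hN, show 2 * h + 1 - h = h + 1 by omega, sq]

/-- The equality case at the level `(p + 1) / 2`. -/
theorem exists_isAP_of_exc_eq_high (hord : ∀ x, ψ x ≠ 0 → Q ≤ addOrderOf x)
    (hQ : 3 * (2 * h + 1) ≤ Q) (hh : 2 ≤ h) (hN : Fintype.card N = 2 * h + 1)
    (hA : IsTransversal ψ A) (hB : IsTransversal ψ B) (heq : exc A B (h + 1) = h ^ 2) :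
    ∃ d, IsAP A d ∧ IsAP B d := by
  have hAc := hA.card_eq
  have hBc := hB.card_eq
  rw [hN] at hAc hBc
  have hAL := hA.largeDiff hord
  have hBL := hB.largeDiff hord
  have hext : Extremal A B (h + 1) := by
    rw [Extremal, heq, hAc, hBc, show 2 * h + 1 - (h + 1) = h by omega, sq]
  have hUL := hB.largeDiff_popular (A := A) (t := h + 1) (by omega) hord
  have hUM := hB.card_popular_le (A := A) (t := h + 1) (by omega)
  rw [hN] at hUM
  set U := univ.filter (fun x => h + 1 ≤ rep A B x) with hU
  have hfin : ∀ d, IsAP A d → ∃ d, IsAP A d ∧ IsAP B d := fun d hd =>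
    ⟨d, hd, hext.symm.isAP hBL hAL (by omega) (by omega) (by omega) (by omega) (by omega) hd⟩
  have hnegc : #(-A) = #A := card_neg A
  -- The level exceeds |A|/2, beyond the reach of `Extremal.exists_isAP`; the dual pair (U, -A)
  -- lives at the admissible level 2h + 1 - t.
  have key : ∀ t, h + 1 ≤ t → t ≤ h + 2 → Extremal A B t → (∀ x ∈ U, t ≤ rep A B x) →
      2 * (2 * h + 1 - t) ≤ #U → ∃ d, IsAP A d ∧ IsAP B d := by
    intro t ht1 ht2 hx hU1 hU2
    obtain ⟨h1, h2⟩ := hx.dual (W := U) hAL (by omega) (by omega) (by omega)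
      (fun x hx => by rw [hU, mem_filter]; exact ⟨mem_univ x, by omega⟩) hU1 (by omega)
    have hsub : univ.filter (fun y => #A - t < rep U (-A) y) ⊆ B := fun y hy =>
      h2 y (mem_filter.1 hy).2
    obtain ⟨d, -, hd⟩ := h1.exists_isAP (M := 2 * h + 1) hQ (by omega) hUL hAL.neg hUM (by omega)
      (by omega) (by omega)
      (fun _ => ⟨hBL.mono hsub, (card_le_card hsub).trans (by omega)⟩)
    exact hfin d hd.of_neg
  by_cases hc : 2 * h ≤ #U
  · exact key (h + 1) le_rfl (by omega) hext (fun x hx => (mem_filter.1 hx).2) (by omega)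
  -- Now U has exactly 2h - 1 elements, all with more than h + 1 representations. The excess drops
  -- to h² - (2h - 1) = (h - 1)², so the pair is also extremal at level h + 2.
  · have h1 := hext.le_card_popular hBL (by omega) (by omega) (by omega)
    have hsub : univ.filter (fun x => h + 1 < rep A B x) ⊆ U :=
      monotone_filter_right _ fun x _ hx => hx.le
    have hTU := eq_of_subset_of_card_le hsub (by omega)
    have h2 := exc_eq_exc_succ_add A B (h + 1)
    have hcU : #U = 2 * h - 1 := by rw [← hTU]; rw [← hTU] at hc; omega
    refine key (h + 2) (by omega) le_rfl ?_ ?_ (by omega)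
    · rw [hTU, heq, hcU] at h2
      rw [Extremal, hAc, hBc]
      obtain ⟨g, rfl⟩ := Nat.exists_eq_add_of_le hh
      rw [show 2 * (2 + g) + 1 - (2 + g + 2) = g + 1 by omega]
      rw [show 2 * (2 + g) - 1 = 2 * g + 3 by omega] at h2
      change exc A B (2 + g + 1 + 1) = _
      nlinarith
    · intro x hx
      rw [← hTU, mem_filter] at hx
      exact hx.2

theorem rep_neg_self_le_of_reflect {A B : Finset G} {x₀ : G} (hAB : ∀ y ∈ A, x₀ - y ∈ B) (g : G) :
    rep A (-A) g ≤ rep B (-B) g := by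
  refine card_le_card_of_injOn (fun y => x₀ - (y - g)) ?_ ?_
  · intro y hy
    rw [mem_coe, mem_filter, mem_neg', neg_sub] at hy
    rw [mem_coe, mem_filter, mem_neg']
    refine ⟨hAB _ hy.2, ?_⟩
    rw [show -(g - (x₀ - (y - g))) = x₀ - y by abel]
    exact hAB _ hy.1
  · intro y _ z _ hyz
    simpa using hyz

theorem rep_le_rep_neg_self {A B : Finset G} {x₀ : G} (hBA : ∀ y ∈ B, x₀ - y ∈ A) (c : G) :
    rep A B c ≤ rep A (-A) (c - x₀) := by
  refine card_le_card fun y hy => ?_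
  rw [mem_filter] at hy ⊢
  refine ⟨hy.1, ?_⟩
  rw [mem_neg']
  convert hBA _ hy.2 using 1
  abel

theorem reflect_of_rep_eq_card {A B : Finset G} {x₀ : G} (h : rep A B x₀ = #A) :
    ∀ y ∈ A, x₀ - y ∈ B := by
  intro y hy
  rw [rep] at h
  have := eq_of_subset_of_card_le (filter_subset _ _) h.ge
  rw [← this, mem_filter] at hy
  exact hy.2

/-- A three-element set meeting a translate of itself twice is a progression. -/
theorem isAP_of_card_three {X : Finset G} {g : G} (hX : #X = 3) (hg : 3 < addOrderOf g)
    (h2 : 2 ≤ rep X (-X) g) : IsAP X g := by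
  refine isAP_of_card_vadd_sdiff_le (by omega) ?_
  have h3 : #((g +ᵥ X) \ X) + #((g +ᵥ X) ∩ X) = #(g +ᵥ X) := card_sdiff_add_card_inter _ _
  rw [rep_neg_self] at h2
  rw [inter_comm, card_vadd_finset] at h3
  omega

/-- The difference of the centres determines the difference inside the fibres. -/
theorem nsmul_diff_eq {φ : G →+ H} {l : ℕ} {X Y : Finset G} {d e : G} (hl : 1 ≤ l)
    (hH : Fintype.card H = 2 * l + 1) (hX : IsTransversal φ X) (hY : IsTransversal φ Y)
    (hXe : IsAP X e) (hYe : IsAP Y e) (he : 2 * (2 * l + 1) ≤ addOrderOf e)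
    (hC : ∀ k, ∃ c, φ c = k ∧ l + 1 ≤ rep X Y c ∧
      ∀ x, φ x = k → 0 < rep X Y x → x = c ∨ x = c + d ∨ x = c - d) :
    (2 * l + 1) • e = d ∨ (2 * l + 1) • e = -d := by
  have hXc := hX.card_eq.trans hH
  have hYc := hY.card_eq.trans hH
  obtain ⟨u, hu⟩ := hXe
  obtain ⟨v, hv⟩ := hYe
  rw [hXc] at hu
  rw [hYc] at hv
  have h1 := rep_ap_ge u v (d := e) (n := 2 * l + 1) (by omega) (2 * l + 1)
  have h0 := rep_ap_ge u v (d := e) (n := 2 * l + 1) (by omega) 0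
  rw [← hu, ← hv] at h0 h1
  rw [zero_nsmul, add_zero] at h0
  obtain ⟨c, hc, hcr, hall⟩ := hC (φ (u + v))
  have hφ : φ (u + v + (2 * l + 1) • e) = φ (u + v) := by
    rw [map_add, map_nsmul, ← hH, card_nsmul_eq_zero, add_zero]
  -- This point lies in the class of u + v and has at least 2l of the 2l + 1 representations
  -- available there, leaving no room for a different c with l + 1.
  have hcx : c = u + v + (2 * l + 1) • e := by
    by_contra hne
    have h2 := hY.sum_rep_fibre (A := X) (φ (u + v))
    have h3 : ∑ z ∈ {c, u + v + (2 * l + 1) • e}, rep X Y z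
        ≤ ∑ z with φ z = φ (u + v), rep X Y z := by
      refine sum_le_sum_of_subset fun z hz => ?_
      rw [mem_insert, mem_singleton] at hz
      rw [mem_filter]
      rcases hz with rfl | rfl
      · exact ⟨mem_univ _, hc⟩
      · exact ⟨mem_univ _, hφ⟩
    rw [sum_pair hne] at h3
    omega
  rcases hall (u + v) rfl (by omega) with h2 | h2 | h2
  · exfalso
    rw [hcx, left_eq_add] at h2
    have := addOrderOf_le_of_nsmul_eq_zero (by omega) h2
    omega
  · right
    rw [hcx, add_assoc, left_eq_add] at h2
    exact eq_neg_of_add_eq_zero_left h2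
  · left
    rw [hcx, add_sub_assoc, left_eq_add, sub_eq_zero] at h2
    exact h2

/-- Fibres which are progressions with centres in progression add up to a progression. -/
theorem isAP_of_fib {φ : G →+ H} {h l : ℕ} {A : Finset G} {a : H → G} {d e : G}
    (ha : ∀ i, φ (a i) = i) (hH : Fintype.card H = 2 * l + 1)
    (hA : #A = (2 * l + 1) * (2 * h + 1)) (hf : ∀ i, fib φ A i = cap (a i) d h)
    (he : IsAP (univ.image a) e) (hde : (2 * l + 1) • e = d ∨ (2 * l + 1) • e = -d) :
    IsAP A e := by
  have hf' : ∀ i, fib φ A i = cap (a i) ((2 * l + 1) • e) h := by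
    intro i
    rcases hde with hde | hde
    · rw [hf, hde]
    · rw [hf, hde, cap_neg_diff]
  obtain ⟨s, hs⟩ := he
  rw [(isTransversal_image_section ha).card_eq, hH] at hs
  refine ⟨s - h • ((2 * l + 1) • e), eq_of_subset_of_card_le ?_ ?_⟩
  · intro y hy
    have h1 : y ∈ fib φ A (φ y) := mem_fib.2 ⟨hy, rfl⟩
    rw [hf', cap, mem_ap] at h1
    obtain ⟨w, hw, hwy⟩ := h1
    have h2 : a (φ y) ∈ univ.image a := mem_image_of_mem a (mem_univ _)
    rw [hs, mem_ap] at h2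
    obtain ⟨u, hu, huy⟩ := h2
    rw [mem_ap]
    -- An expansion in base 2l + 1: u locates the centre and w the place within the fibre.
    refine ⟨u + w * (2 * l + 1), ?_, ?_⟩
    · rw [hA]
      have : w * (2 * l + 1) ≤ 2 * h * (2 * l + 1) := Nat.mul_le_mul_right _ (by omega)
      nlinarith
    · rw [← hwy, ← huy, add_nsmul _ u, mul_nsmul' e w]
      generalize (2 * l + 1) • e = f
      abel
  · rw [ap]
    exact card_image_le.trans (by rw [card_range])

end Abstract

/-! ### The induction step for the bound and for equality -/

section Step

variable {G N H : Type*} [AddCommGroup G] [DecidableEq G] [Fintype G]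
  [AddCommGroup N] [DecidableEq N] [Fintype N] [AddCommGroup H] [DecidableEq H] [Fintype H]
  {ψ : G →+ N} {θ : N →+ H} {h l Q : ℕ} {A B : Finset G}

theorem sum_bound_eq_sq (h l : ℕ) :
    (2 * l + 1) * ((2 * l + 1) * h ^ 2 + 2 * h * l) + l ^ 2 = ((2 * l + 1) * h + l) ^ 2 := by
  ring

/-- The bound for the sections through the centres implies the bound for the sets. -/
theorem Tower.exc_le_sq (S : Tower ψ θ h l Q A B)
    (hle : ∀ X Y, IsTransversal (θ.comp ψ) X → IsTransversal (θ.comp ψ) Y →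
      exc X Y (l + 1) ≤ l ^ 2) :
    exc A B ((2 * l + 1) * h + l + 1) ≤ ((2 * l + 1) * h + l) ^ 2 := by
  obtain ⟨a, b, C⟩ := S.exists_centres
  have h1 := C.exc_le
  have h2 := hle _ _ (isTransversal_image_section C.map_left)
    (isTransversal_image_section C.map_right)
  have h3 := sum_bound_eq_sq h l
  omega

theorem exists_lt_rep_of_exc_pos {X Y : Finset G} {t : ℕ} (h : 0 < exc X Y t) :
    ∃ x, t < rep X Y x := by
  by_contra! hne
  exact h.ne' (sum_eq_zero fun x _ => Nat.sub_eq_zero_of_le (hne x))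

theorem two_le_rep_neg_self {X : Finset G} {u v w : G} (hu : u ∈ X) (hv : v ∈ X) (hw : w ∈ X)
    (hvw : v ≠ w) (h : u + v = w + w) : 2 ≤ rep X (-X) (w - u) := by
  rw [← card_pair hvw]
  refine card_le_card fun y hy => ?_
  rw [mem_insert, mem_singleton] at hy
  rw [mem_filter, mem_neg']
  rcases hy with rfl | rfl
  · refine ⟨hv, ?_⟩
    rw [show -(w - u - y) = w by rw [neg_sub, sub_sub_eq_add_sub, add_comm, h]; abel]
    exact hw
  · refine ⟨hw, ?_⟩
    rw [show -(y - u - y) = u by abel]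
    exact hu

theorem IsAP.exists_rep_eq_card {X Y : Finset G} {e : G} {n : ℕ} (hX : IsAP X e) (hY : IsAP Y e)
    (hXn : #X = n) (hYn : #Y = n) (hn : 1 ≤ n) (he : n ≤ addOrderOf e) :
    ∃ x, rep X Y x = n := by
  obtain ⟨u, hu⟩ := hX
  obtain ⟨v, hv⟩ := hY
  have h1 := rep_ap_ge u v he (n - 1)
  rw [hXn] at hu
  rw [hYn] at hv
  rw [← hu, ← hv] at h1
  have h2 := rep_le_card_left X Y (u + v + (n - 1) • e)
  exact ⟨u + v + (n - 1) • e, by omega⟩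

/-- The equality case passes from the sections through the centres to the sets. -/
theorem Tower.exists_isAP (S : Tower ψ θ h l Q A B) (hl : 1 ≤ l)
    (hord : ∀ X e, IsTransversal (θ.comp ψ) X → IsAP X e → 2 * (2 * l + 1) ≤ addOrderOf e)
    (hle : ∀ X Y, IsTransversal (θ.comp ψ) X → IsTransversal (θ.comp ψ) Y →
      exc X Y (l + 1) ≤ l ^ 2)
    (hAP : (l = 1 ∧ ∀ x, θ.comp ψ x ≠ 0 → 4 ≤ addOrderOf x) ∨ ∀ X Y, IsTransversal (θ.comp ψ) X → IsTransversal (θ.comp ψ) Y →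
      exc X Y (l + 1) = l ^ 2 → ∃ d, IsAP X d ∧ IsAP Y d)
    (heq : exc A B ((2 * l + 1) * h + l + 1) = ((2 * l + 1) * h + l) ^ 2) :
    ∃ d, IsAP A d ∧ IsAP B d := by
  obtain ⟨a, b, C⟩ := S.exists_centres
  have hX := isTransversal_image_section C.map_left
  have hY := isTransversal_image_section C.map_right
  have hXc := hX.card_eq.trans S.hH
  have hYc := hY.card_eq.trans S.hH
  have h1 := C.exc_le
  have h2 := hle _ _ hX hY
  have h3 := sum_bound_eq_sq h l
  have hex : exc (univ.image a) (univ.image b) (l + 1) = l ^ 2 := by omega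
  suffices hs : ∃ e d, IsAP (univ.image a) e ∧ IsAP (univ.image b) e ∧
      (∀ i, fib (θ.comp ψ) A i = cap (a i) d h) ∧ (∀ i, fib (θ.comp ψ) B i = cap (b i) d h) ∧
      ∀ k, ∃ c, θ.comp ψ c = k ∧ l + 1 ≤ rep (univ.image a) (univ.image b) c ∧
        ∀ x, θ.comp ψ x = k → 0 < rep (univ.image a) (univ.image b) x →
          x = c ∨ x = c + d ∨ x = c - d by
    obtain ⟨e, d, hae, hbe, hfA, hfB, hC⟩ := hs
    have he := hord _ _ hX hae
    have hde := nsmul_diff_eq hl S.hH hX hY hae hbe he hC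
    exact ⟨e, isAP_of_fib C.map_left S.hH S.card_left hfA hae hde,
      isAP_of_fib C.map_right S.hH ((S.hB.card_eq.trans S.hA.card_eq.symm).trans S.card_left) hfB hbe hde⟩
  -- For l = 1 a positive excess at level 2 already requires a sum with all three representations;
  -- no classification of the sections is needed.
  have hx₀ : ∃ x₀, rep (univ.image a) (univ.image b) x₀ = 2 * l + 1 := by
    rcases hAP with ⟨rfl, h4⟩ | hAP
    · obtain ⟨x, hx⟩ := exists_lt_rep_of_exc_pos (by rw [hex]; norm_num :
        0 < exc (univ.image a) (univ.image b) (1 + 1))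
      have := rep_le_card_left (univ.image a) (univ.image b) x
      exact ⟨x, by omega⟩
    · obtain ⟨e, hae, hbe⟩ := hAP _ _ hX hY hex
      have he := hord _ _ hX hae
      exact hae.exists_rep_eq_card hbe hXc hYc (by omega) (by omega)
  obtain ⟨x₀, hx₀⟩ := hx₀
  obtain ⟨d, hfA, hfB, hC⟩ := C.of_exc_eq hl (by omega) hx₀
  rcases hAP with ⟨rfl, h4⟩ | hAP
  -- The sections are reflections of each other in x₀. A sum with two representations over another
  -- class makes the first meet a translate of itself twice, so both are progressions.
  · have hAB := reflect_of_rep_eq_card (hx₀.trans hXc.symm)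
    have hBA := reflect_of_rep_eq_card ((rep_comm _ _ _).trans (hx₀.trans hYc.symm))
    obtain ⟨k, hk⟩ : ∃ k : H, k ≠ θ.comp ψ x₀ := by
      have : Nontrivial H := Fintype.one_lt_card_iff_nontrivial.1 (by rw [S.hH]; norm_num)
      exact exists_ne _
    obtain ⟨c, hc, hc2, -⟩ := hC k
    have hg : 3 < addOrderOf (c - x₀) :=
      h4 (c - x₀) (by rw [map_sub, hc]; exact sub_ne_zero.2 hk)
    have hr := hc2.trans (rep_le_rep_neg_self hBA c)
    exact ⟨c - x₀, d, isAP_of_card_three hXc hg hr,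
      isAP_of_card_three hYc hg (hr.trans (rep_neg_self_le_of_reflect hAB _)), hfA, hfB, hC⟩
  · obtain ⟨e, hae, hbe⟩ := hAP _ _ hX hY hex
    exact ⟨e, d, hae, hbe, hfA, hfB, hC⟩

end Step

/-! ### Reduction modulo powers of p -/

theorem card_fibre_mul {N H : Type*} [AddCommGroup N] [DecidableEq N] [Fintype N] [AddCommGroup H]
    [DecidableEq H] [Fintype H] {θ : N →+ H} (hθ : Function.Surjective θ) (i : H) :
    Fintype.card H * #{c | θ c = i} = Fintype.card N := by
  have h := card_eq_sum_card_fiberwise (f := θ) (s := univ) (t := univ) fun _ _ => by simp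
  rw [← card_univ (α := N), h, ← card_univ, ← smul_eq_mul, ← sum_const]
  exact sum_congr rfl fun j _ => AddMonoidHom.card_fiber_eq_of_mem_range θ (hθ i) (hθ j)

section Reduction

variable {p : ℕ} [Fact p.Prime]

/-- Reduction modulo `p ^ j`. -/
def red (p : ℕ) {j k : ℕ} (hj : j ≤ k) : ZMod (p ^ k) →+ ZMod (p ^ j) :=
  (ZMod.castHom (pow_dvd_pow p hj) (ZMod (p ^ j))).toAddMonoidHom

theorem red_natCast {j k : ℕ} (hj : j ≤ k) (m : ℕ) : red p hj (m : ZMod (p ^ k)) = m :=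
  map_natCast (ZMod.castHom (pow_dvd_pow p hj) (ZMod (p ^ j))) m

theorem red_surjective {j k : ℕ} (hj : j ≤ k) : Function.Surjective (red p hj) :=
  ZMod.castHom_surjective (pow_dvd_pow p hj)

theorem exists_natCast_eq {k : ℕ} (x : ZMod (p ^ k)) : ∃ m : ℕ, (m : ZMod (p ^ k)) = x :=
  ⟨x.val, ZMod.natCast_zmod_val x⟩

theorem red_red {i j k : ℕ} (hi : i ≤ j) (hj : j ≤ k) (x : ZMod (p ^ k)) :
    red p hi (red p hj x) = red p (hi.trans hj) x := by
  obtain ⟨m, rfl⟩ := exists_natCast_eq x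
  simp only [red_natCast]

theorem red_comp {i j k : ℕ} (hi : i ≤ j) (hj : j ≤ k) :
    (red p hi).comp (red p hj) = red p (hi.trans hj) := by
  ext x
  exact red_red hi hj x

theorem red_eq_zero_iff {j k : ℕ} (hj : j ≤ k) (x : ZMod (p ^ k)) :
    red p hj x = 0 ↔ x ∈ AddSubgroup.zmultiples ((p ^ j : ℕ) : ZMod (p ^ k)) := by
  obtain ⟨m, rfl⟩ := exists_natCast_eq x
  rw [red_natCast, AddSubgroup.mem_zmultiples_iff]
  constructor
  · intro h
    obtain ⟨c, rfl⟩ := (ZMod.natCast_eq_zero_iff _ _).1 h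
    exact ⟨c, by push_cast; rw [zsmul_eq_mul, Int.cast_natCast, mul_comm]⟩
  · rintro ⟨c, hc⟩
    rw [← red_natCast hj, ← hc, map_zsmul, red_natCast, ZMod.natCast_self, smul_zero]

/-- The order is a power of p; if it divided p^(k - j), then p^j would divide x. -/
theorem le_addOrderOf_of_red_ne_zero {j k : ℕ} (hj : j ≤ k) {x : ZMod (p ^ k)}
    (hx : red p hj x ≠ 0) : p ^ (k - j + 1) ≤ addOrderOf x := by
  have hp := Fact.out (p := p.Prime)
  have h1 : addOrderOf x ∣ p ^ k := by
    have := addOrderOf_dvd_card (x := x)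
    rwa [ZMod.card] at this
  obtain ⟨s, hs, hs'⟩ := (Nat.dvd_prime_pow hp).1 h1
  rw [hs']
  refine Nat.pow_le_pow_right hp.pos ?_
  by_contra hlt
  refine hx ?_
  obtain ⟨m, rfl⟩ := exists_natCast_eq x
  have h2 : p ^ (k - j) • (m : ZMod (p ^ k)) = 0 := by
    rw [← addOrderOf_dvd_iff_nsmul_eq_zero, hs']
    exact pow_dvd_pow p (by omega)
  rw [nsmul_eq_mul, ← Nat.cast_mul, ZMod.natCast_eq_zero_iff] at h2
  rw [red_natCast, ZMod.natCast_eq_zero_iff]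
  refine Nat.dvd_of_mul_dvd_mul_left (pow_pos hp.pos (k - j)) ?_
  rwa [← pow_add, Nat.sub_add_cancel hj]

theorem card_fibre_red (j : ℕ) (i : ZMod (p ^ j)) :
    #{c | red p (Nat.le_succ j) c = i} = p := by
  have h := card_fibre_mul (red_surjective (p := p) (Nat.le_succ j)) i
  rw [ZMod.card, ZMod.card] at h
  exact Nat.eq_of_mul_eq_mul_left (pow_pos (Fact.out (p := p.Prime)).pos j) (h.trans (pow_succ p j))

/-- The difference of a progression which is a transversal is a generator. -/
theorem pow_le_addOrderOf_of_isAP {j k : ℕ} (hj : j ≤ k) (hj1 : 1 ≤ j) {X : Finset (ZMod (p ^ k))}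
    (hX : IsTransversal (red p hj) X) {e : ZMod (p ^ k)} (he : IsAP X e) :
    p ^ k ≤ addOrderOf e := by
  have hp := Fact.out (p := p.Prime)
  -- If e vanished modulo p, all elements of X would agree modulo p, although X meets every class.
  have h1 : red p (hj1.trans hj) e ≠ 0 := by
    intro h0
    have : Fact (1 < p ^ 1) := ⟨by rw [pow_one]; exact hp.one_lt⟩
    obtain ⟨x, ⟨hx, hx'⟩, -⟩ := hX 0
    obtain ⟨y, ⟨hy, hy'⟩, -⟩ := hX ((1 : ℕ) : ZMod (p ^ j))
    obtain ⟨a, ha⟩ := he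
    rw [ha, mem_ap] at hx hy
    obtain ⟨u, -, hu⟩ := hx
    obtain ⟨v, -, hv⟩ := hy
    have e1 : red p (hj1.trans hj) x = 0 := by rw [← red_red hj1 hj, hx', map_zero]
    have e2 : red p (hj1.trans hj) y = 1 := by rw [← red_red hj1 hj, hy', red_natCast, Nat.cast_one]
    rw [← hu, map_add, map_nsmul, h0, smul_zero, add_zero] at e1
    rw [← hv, map_add, map_nsmul, h0, smul_zero, add_zero, e1] at e2
    exact zero_ne_one e2
  have h2 := le_addOrderOf_of_red_ne_zero _ h1
  rwa [Nat.sub_add_cancel (hj1.trans hj)] at h2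

theorem isTransversal_of_isDigitalSet {α β : ℕ} (hαβ : α ≤ β) {A : Finset (ZMod (p ^ β))}
    (hA : IsDigitalSet (p ^ α) A) : IsTransversal (red p hαβ) A := by
  intro c
  obtain ⟨x, rfl⟩ := red_surjective hαβ c
  have h := hA.2 x
  simp only [← red_eq_zero_iff hαβ, map_sub, sub_eq_zero, eq_comm (a := red p hαβ x)] at h
  exact h

/-- The hypotheses mean distinctness modulo 3. Then a + b + c is a multiple of 3, and 3a, 3b, 3c run
through 0, 3, 6, so one of them equals it. -/
theorem add_eq_two_mul_of_zmod_nine : ∀ a b c : ZMod (3 ^ 2), 3 • (a - b) ≠ 0 → 3 • (a - c) ≠ 0 →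
    3 • (b - c) ≠ 0 → a + b = c + c ∨ b + c = a + a ∨ c + a = b + b := by
  decide

end Reduction

/-! ### Digital sets modulo prime powers -/

section Main

variable {p : ℕ} [Fact p.Prime] {β : ℕ}

/-- The exceptional prime in the smallest modulus: any three residues modulo nine which are
distinct modulo three form a progression. -/
theorem exists_isAP_of_three (hβ : 1 ≤ 2) {A B : Finset (ZMod (3 ^ 2))}
    (hA : IsTransversal (red 3 hβ) A) (hB : IsTransversal (red 3 hβ) B)
    (heq : exc A B 2 = 1) : ∃ d, IsAP A d ∧ IsAP B d := by
  have hAc : #A = 3 := by rw [hA.card_eq, ZMod.card, pow_one]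
  have hBc : #B = 3 := by rw [hB.card_eq, ZMod.card, pow_one]
  obtain ⟨x₀, hx₀⟩ := exists_lt_rep_of_exc_pos (by rw [heq]; norm_num : 0 < exc A B 2)
  have h1 := rep_le_card_left A B x₀
  have hAB := reflect_of_rep_eq_card (A := A) (B := B) (x₀ := x₀) (by omega)
  have hord : ∀ x : ZMod (3 ^ 2), red 3 hβ x ≠ 0 → 3 < addOrderOf x := fun x hx => by
    have := le_addOrderOf_of_red_ne_zero hβ hx
    norm_num at this
    omega
  have hne : ∀ x ∈ A, ∀ y ∈ A, x ≠ y → 3 • (x - y) ≠ 0 := by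
    intro x hx y hy hxy h0
    have h2 := hord (x - y) fun h => hxy (hA.injOn hx hy (by rwa [map_sub, sub_eq_zero] at h))
    have := addOrderOf_le_of_nsmul_eq_zero three_pos h0
    omega
  suffices h : ∃ u ∈ A, ∃ v ∈ A, ∃ w ∈ A, v ≠ w ∧ w ≠ u ∧ u + v = w + w by
    obtain ⟨u, hu, v, hv, w, hw, hvw, hwu, h⟩ := h
    have h2 := two_le_rep_neg_self hu hv hw hvw h
    have h3 := hord (w - u) fun h => hwu (hA.injOn hw hu (by rwa [map_sub, sub_eq_zero] at h))
    exact ⟨w - u, isAP_of_card_three hAc h3 h2, isAP_of_card_three hBc h3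
      (h2.trans (rep_neg_self_le_of_reflect hAB _))⟩
  obtain ⟨a, b, c, hab, hac, hbc, rfl⟩ := card_eq_three.1 hAc
  have ha : a ∈ ({a, b, c} : Finset (ZMod (3 ^ 2))) := by simp
  have hb : b ∈ ({a, b, c} : Finset (ZMod (3 ^ 2))) := by simp
  have hc : c ∈ ({a, b, c} : Finset (ZMod (3 ^ 2))) := by simp
  rcases add_eq_two_mul_of_zmod_nine a b c (hne a ha b hb hab) (hne a ha c hc hac)
    (hne b hb c hc hbc) with h | h | h
  · exact ⟨a, ha, b, hb, c, hc, hbc, hac.symm, h⟩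
  · exact ⟨b, hb, c, hc, a, ha, hac.symm, hab, h⟩
  · exact ⟨c, hc, a, ha, b, hb, hab, hbc, h⟩

theorem exc_le_sq_one {h : ℕ} (hp : p = 2 * h + 1) (hβ : 1 < β) {A B : Finset (ZMod (p ^ β))}
    (hA : IsTransversal (red p hβ.le) A) (hB : IsTransversal (red p hβ.le) B) :
    exc A B (h + 1) ≤ h ^ 2 := by
  have hpp := Fact.out (p := p.Prime)
  have hAc : #A = 2 * h + 1 := by rw [hA.card_eq, ZMod.card, pow_one, hp]
  have hBc : #B = 2 * h + 1 := by rw [hB.card_eq, ZMod.card, pow_one, hp]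
  have hQ : 2 * p ≤ p ^ (β - 1 + 1) := by
    rw [pow_succ]
    exact Nat.mul_le_mul_right p (hpp.two_le.trans (Nat.le_self_pow (by omega) p))
  have h1 := exc_le (A := A) (t := h + 1)
    (hB.largeDiff fun x hx => le_addOrderOf_of_red_ne_zero hβ.le hx) (by omega)
    (by have := hpp.two_le; omega) (by have := hpp.two_le; omega)
  rwa [hAc, hBc, show 2 * h + 1 - (h + 1) = h by omega, ← sq] at h1

theorem three_mul_le_pow {k : ℕ} (h3 : 3 ≤ p) (hk : 2 ≤ k) : 3 * p ≤ p ^ k :=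
  calc 3 * p ≤ p * p := Nat.mul_le_mul_right p h3
    _ = p ^ 2 := (sq p).symm
    _ ≤ p ^ k := Nat.pow_le_pow_right (by omega) hk

theorem exists_isAP_one {h : ℕ} (hp : p = 2 * h + 1) (hβ : 1 < β) (hex : ¬ (p = 3 ∧ 3 ≤ β))
    {A B : Finset (ZMod (p ^ β))} (hA : IsTransversal (red p hβ.le) A)
    (hB : IsTransversal (red p hβ.le) B) (heq : exc A B (h + 1) = h ^ 2) :
    ∃ d, IsAP A d ∧ IsAP B d := by
  have hpp := Fact.out (p := p.Prime)
  have h2 := hpp.two_le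
  by_cases hh : 2 ≤ h
  · refine exists_isAP_of_exc_eq_high (fun x hx => le_addOrderOf_of_red_ne_zero hβ.le hx) ?_ hh ?_
      hA hB heq
    · rw [← hp]
      exact three_mul_le_pow (by omega) (by omega)
    · rw [ZMod.card, pow_one, hp]
  · obtain rfl : h = 1 := by omega
    obtain rfl : p = 3 := hp
    obtain rfl : β = 2 := by omega
    exact exists_isAP_of_three hβ.le hA hB heq

/-- Since α + 1 < β, the relevant orders are at least p^(β - α) ≥ p² ≥ 3p, enough for fibres of size
p. -/
theorem tower_red {h l α : ℕ} (hp : p = 2 * h + 1) (hα : α + 1 < β) (hl : p ^ α = 2 * l + 1)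
    {A B : Finset (ZMod (p ^ β))} (hA : IsTransversal (red p hα.le) A)
    (hB : IsTransversal (red p hα.le) B) :
    Tower (red p hα.le) (red p (Nat.le_succ α)) h l (p ^ (β - (α + 1) + 1)) A B where
  hord _ hx := le_addOrderOf_of_red_ne_zero hα.le hx
  hQ := by
    have := (Fact.out (p := p.Prime)).two_le
    rw [← hp]
    exact three_mul_le_pow (by omega) (by omega)
  hh := by
    have := (Fact.out (p := p.Prime)).two_le
    omega
  hH := by rw [ZMod.card, hl]
  hfib i := (card_fibre_red α i).trans hp
  hA := hA
  hB := hB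

/-- The bound at the level `(p ^ α + 1) / 2` and its equality case. -/
theorem exc_le_sq_and_exists_isAP {h : ℕ} (hp : p = 2 * h + 1) {α : ℕ} (hα : 1 ≤ α) :
    ∀ (hαβ : α < β) (r : ℕ), p ^ α = 2 * r + 1 → ∀ A B : Finset (ZMod (p ^ β)),
      IsTransversal (red p hαβ.le) A → IsTransversal (red p hαβ.le) B →
      exc A B (r + 1) ≤ r ^ 2 ∧ (¬ (p = 3 ∧ α = 1 ∧ 3 ≤ β) → exc A B (r + 1) = r ^ 2 →
        ∃ d, IsAP A d ∧ IsAP B d) := by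
  have hpp := Fact.out (p := p.Prime)
  have hp2 := hpp.two_le
  induction α, hα using Nat.le_induction with
  | base =>
    intro hβ r hr A B hA hB
    obtain rfl : r = h := by rw [pow_one] at hr; omega
    exact ⟨exc_le_sq_one hp hβ hA hB, fun hex =>
      exists_isAP_one hp hβ (fun hc => hex ⟨hc.1, rfl, hc.2⟩) hA hB⟩
  | succ α hα ih =>
    intro hαβ r hr A B hA hB
    obtain ⟨l, hl⟩ : Odd (p ^ α) := Odd.pow ⟨h, hp⟩
    have hl1 : 1 ≤ l := by
      have := Nat.le_self_pow (n := α) (by omega) p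
      omega
    have hrl : r = (2 * l + 1) * h + l := by
      rw [pow_succ, hl, hp] at hr
      nlinarith
    have S := tower_red hp hαβ hl hA hB
    have hαβ' : α < β := by omega
    have hcomp : (red p (Nat.le_succ α)).comp (red p hαβ.le) = red p hαβ'.le := red_comp _ _
    have IH := ih hαβ' l hl
    rw [← hcomp] at IH
    subst hrl
    refine ⟨S.exc_le_sq fun X Y hX hY => (IH X Y hX hY).1, fun hex => S.exists_isAP hl1 ?_
      (fun X Y hX hY => (IH X Y hX hY).1) ?_⟩
    · intro X e hX he
      rw [hcomp] at hX
      refine le_trans ?_ (pow_le_addOrderOf_of_isAP hαβ'.le hα hX he)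
      rw [← hl]
      calc 2 * p ^ α ≤ p * p ^ α := Nat.mul_le_mul_right _ hp2
        _ = p ^ (α + 1) := (pow_succ' p α).symm
        _ ≤ p ^ β := Nat.pow_le_pow_right (by omega) hαβ.le
    -- Here β ≥ 3, so for p = 3 the case α = 1 is the exception and offers no equality statement;
    -- the first alternative of `Tower.exists_isAP` replaces it.
    · by_cases hc : p = 3 ∧ α = 1
      · left
        obtain ⟨rfl, rfl⟩ := hc
        refine ⟨by omega, fun x hx => ?_⟩
        rw [hcomp] at hx
        refine le_trans ?_ (le_addOrderOf_of_red_ne_zero _ hx)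
        calc 4 ≤ 3 ^ 2 := by norm_num
          _ ≤ 3 ^ (β - 1 + 1) := Nat.pow_le_pow_right (by omega) (by omega)
      · right
        exact fun X Y hX hY => (IH X Y hX hY).2 fun h => hc ⟨h.1, h.2.1⟩

variable {α r : ℕ} {A B : Finset (ZMod (p ^ β))}

/-- Lowering the level from r + 1 to r adds one for each sum with more than r representations. There
is at most one in each of the 2r + 1 classes, and r² + (2r + 1) = (r + 1)². -/
theorem exc_le_succ_sq (hp : Odd p) (hα : 1 ≤ α) (hαβ : α < β) (hr : p ^ α = 2 * r + 1)
    (hA : IsTransversal (red p hαβ.le) A) (hB : IsTransversal (red p hαβ.le) B) :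
    exc A B r ≤ (r + 1) ^ 2 ∧ (exc A B r = (r + 1) ^ 2 → exc A B (r + 1) = r ^ 2) := by
  obtain ⟨h, hh⟩ := hp
  have h1 := (exc_le_sq_and_exists_isAP hh hα hαβ r hr A B hA hB).1
  have h2 := exc_eq_exc_succ_add A B r
  have h3 := hB.card_popular_le (A := A) (t := r + 1) (by
    rw [hA.card_eq, ZMod.card, hr]; omega)
  rw [ZMod.card, hr] at h3
  simp only [Order.add_one_le_iff] at h3
  constructor
  · nlinarith
  · intro h4
    nlinarith

theorem exists_isAP_of_exc_eq (hp : Odd p) (hα : 1 ≤ α) (hαβ : α < β) (hr : p ^ α = 2 * r + 1)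
    (hA : IsTransversal (red p hαβ.le) A) (hB : IsTransversal (red p hαβ.le) B)
    (heq : exc A B r = (r + 1) ^ 2) : ∃ d, IsAP A d ∧ IsAP B d := by
  have h1 := (exc_le_succ_sq hp hα hαβ hr hA hB).2 heq
  obtain ⟨h, hh⟩ := hp
  have h2 := (Fact.out (p := p.Prime)).two_le
  -- For α = 1 level r is treated directly, because p = 3 may be exceptional at level r + 1; for
  -- larger α equality is inherited at level r + 1, where no exception remains.
  by_cases hc : α = 1
  · subst hc
    obtain rfl : r = h := by rw [pow_one] at hr; omega
    refine exists_isAP_of_exc_eq_low (fun x hx => le_addOrderOf_of_red_ne_zero hαβ.le hx) ?_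
      (by omega) ?_ hA hB heq
    · rw [← hh]
      exact three_mul_le_pow (by omega) (by omega)
    · rw [ZMod.card, hr]
  · exact (exc_le_sq_and_exists_isAP hh hα hαβ r hr A B hA hB).2 (fun h => hc h.2.1) h1

theorem sq_le_exc_of_isAP (hα : 1 ≤ α) (hαβ : α < β) {n : ℕ} (hn : p ^ α = n)
    (hA : IsTransversal (red p hαβ.le) A) (hB : IsTransversal (red p hαβ.le) B)
    {d : ZMod (p ^ β)} (hAd : IsAP A d) (hBd : IsAP B d) (t : ℕ) :
    (n - t) ^ 2 ≤ exc A B t := by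
  have hp2 := (Fact.out (p := p.Prime)).two_le
  have hd := pow_le_addOrderOf_of_isAP hαβ.le hα hA hAd
  have hAc := hA.card_eq
  have hBc := hB.card_eq
  rw [ZMod.card, hn] at hAc hBc
  obtain ⟨x, hx⟩ := hAd
  obtain ⟨y, hy⟩ := hBd
  rw [hAc] at hx
  rw [hBc] at hy
  rw [hx, hy]
  refine sq_le_exc_ap x y (le_trans ?_ hd)
  rw [← hn]
  calc 2 * p ^ α ≤ p * p ^ α := Nat.mul_le_mul_right _ hp2
    _ = p ^ (α + 1) := (pow_succ' p α).symm
    _ ≤ p ^ β := Nat.pow_le_pow_right (by omega) hαβ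

theorem repCount_eq_rep {q : ℕ} (A B : Finset (ZMod q)) (x : ZMod q) :
    repCount A B x = rep A B x := by
  refine card_bij' (fun z _ => z.1) (fun a _ => (a, x - a)) ?_ ?_ ?_ ?_
  · rintro ⟨a, b⟩ h
    rw [mem_filter, mem_product] at h
    obtain ⟨⟨ha, hb⟩, rfl⟩ := h
    rw [mem_filter, add_sub_cancel_left]
    exact ⟨ha, hb⟩
  · intro a h
    rw [mem_filter] at h
    rw [mem_filter, mem_product]
    exact ⟨h, add_sub_cancel a x⟩
  · rintro ⟨a, b⟩ h
    rw [mem_filter] at h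
    obtain ⟨-, rfl⟩ := h
    rw [add_sub_cancel_left]
  · intro a _
    rfl

theorem pollardSum_add_exc {q : ℕ} [NeZero q] (A B : Finset (ZMod q)) (t : ℕ) :
    pollardSum A B t + exc A B t = #A * #B := by
  rw [pollardSum_eq_sum_min, exc, ← sum_add_distrib, ← sum_rep]
  refine sum_congr rfl fun x _ => ?_
  rw [repCount_eq_rep]
  omega

theorem isArithProgWithDiff_iff {q : ℕ} (A : Finset (ZMod q)) (d : ZMod q) :
    IsArithProgWithDiff A d ↔ IsAP A d := by
  simp only [IsArithProgWithDiff, IsAP, ap, nsmul_eq_mul]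

end Main

end DigitalPollard

open DigitalPollard in
theorem theorem2 (p α β : ℕ) (hp : p.Prime) (hp_odd : Odd p) (hα : 0 < α) (hαβ : α < β)
    (A B : Finset (ZMod (p ^ β)))
    (hA : IsDigitalSet (p ^ α) A) (hB : IsDigitalSet (p ^ α) B) :
    (3 * (p : ℚ) ^ (2 * α) - 2 * (p : ℚ) ^ α - 1) / 4
        ≤ (pollardSum A B ((p ^ α - 1) / 2) : ℚ) ∧
    (3 * (p : ℚ) ^ (2 * α) + 2 * (p : ℚ) ^ α - 1) / 4
        ≤ (pollardSum A B ((p ^ α + 1) / 2) : ℚ) ∧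
    ((pollardSum A B ((p ^ α - 1) / 2) : ℚ)
          = (3 * (p : ℚ) ^ (2 * α) - 2 * (p : ℚ) ^ α - 1) / 4 ↔
        ∃ d : ZMod (p ^ β), IsArithProgWithDiff A d ∧ IsArithProgWithDiff B d) ∧
    (¬ (p = 3 ∧ α = 1 ∧ 3 ≤ β) →
      ((pollardSum A B ((p ^ α + 1) / 2) : ℚ)
          = (3 * (p : ℚ) ^ (2 * α) + 2 * (p : ℚ) ^ α - 1) / 4 ↔
        ∃ d : ZMod (p ^ β), IsArithProgWithDiff A d ∧ IsArithProgWithDiff B d)) := by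
  have : Fact p.Prime := ⟨hp⟩
  obtain ⟨r, hr⟩ : Odd (p ^ α) := hp_odd.pow
  obtain ⟨h, hh⟩ := hp_odd
  have hA' := isTransversal_of_isDigitalSet hαβ.le hA
  have hB' := isTransversal_of_isDigitalSet hαβ.le hB
  have hcast : (p : ℚ) ^ α = 2 * r + 1 := by exact_mod_cast hr
  rw [pow_mul', hcast, show (p ^ α - 1) / 2 = r by omega, show (p ^ α + 1) / 2 = r + 1 by omega]
  have s1 := pollardSum_add_exc A B r
  have s2 := pollardSum_add_exc A B (r + 1)
  rw [hA.1, hB.1, hr] at s1 s2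
  have t1 : (pollardSum A B r : ℚ) + exc A B r = (2 * r + 1) * (2 * r + 1) := by exact_mod_cast s1
  have t2 : (pollardSum A B (r + 1) : ℚ) + exc A B (r + 1) = (2 * r + 1) * (2 * r + 1) := by
    exact_mod_cast s2
  have b1 := (exc_le_succ_sq ⟨h, hh⟩ hα hαβ hr hA' hB').1
  obtain ⟨b2, e2⟩ := exc_le_sq_and_exists_isAP hh hα hαβ r hr A B hA' hB'
  have c1 : (exc A B r : ℚ) ≤ (r + 1) ^ 2 := by exact_mod_cast b1
  have c2 : (exc A B (r + 1) : ℚ) ≤ r ^ 2 := by exact_mod_cast b2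
  simp only [isArithProgWithDiff_iff]
  refine ⟨by linarith, by linarith, ⟨fun heq => ?_, ?_⟩, fun hex => ⟨fun heq => ?_, ?_⟩⟩
  · refine exists_isAP_of_exc_eq ⟨h, hh⟩ hα hαβ hr hA' hB' ?_
    have : (exc A B r : ℚ) = (r + 1) ^ 2 := by linarith
    exact_mod_cast this
  · rintro ⟨d, hAd, hBd⟩
    have h1 := sq_le_exc_of_isAP hα hαβ hr hA' hB' hAd hBd r
    rw [show 2 * r + 1 - r = r + 1 by omega] at h1
    have h2 : (exc A B r : ℚ) = (r + 1) ^ 2 := by exact_mod_cast le_antisymm b1 h1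
    linarith
  · refine e2 hex ?_
    have : (exc A B (r + 1) : ℚ) = r ^ 2 := by linarith
    exact_mod_cast this
  · rintro ⟨d, hAd, hBd⟩
    have h1 := sq_le_exc_of_isAP hα hαβ hr hA' hB' hAd hBd (r + 1)
    rw [show 2 * r + 1 - (r + 1) = r by omega] at h1
    have h2 : (exc A B (r + 1) : ℚ) = r ^ 2 := by exact_mod_cast le_antisymm b2 h1
    linarith
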